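/- Let $n\ge 1$, let $(\Omega,\mathcal F,\mathbb P)$ be a probability space, and let $\phi\in C^\infty(\mathbb R^n\times\mathbb R)$ be an obstacle shape: there are $r_0,r_1$ with $r_1>\sqrt n\,r_0>0$ such that $\phi\le 0$, $\phi(x,y)=0$ whenever $\|(x,y)\|>r_1$ (Euclidean norm), and $\phi(x,y)\le -1$ whenever $\|(x,y)\|_\infty\le r_0$. Let the obstacle centres $(x_k,y_k)_{k\in\mathbb N}$ be the points of a Poisson process on $\mathbb R^n\times[r_1,\infty)$ with constant intensity $\lambda>0$ with respect to Lebesgue measure, let the strengths $(f_k)_{k\in\mathbb N}$ be i.i.d. (almost surely) strictly positive random variables, independent of $(x_k,y_k)_{k\in\mathbb N}$, and put $$f(x,y,\omega)=\sum_{k} f_k(\omega)\,\phi\bigl(x-x_k(\omega),\,y-y_k(\omega)\bigr).$$ For a function $u$ on $\mathbb R^n$ let $\kappa(u)=\operatorname{div}\left(\frac{\nabla u}{n\sqrt{1+|\nabla u|^2}}\right)$ be the mean curvature operator of its graph. Then there exist a (deterministic) constant $F^*>0$ and a measurable function $w\colon\mathbb R^n\times\Omega\to[0,\infty)$ such that for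 almost every $\omega$: 1. $0\ge \kappa(w(\cdot,\omega))(x)+f(x,w(x,\omega),\omega)+F^*$ on $\mathbb R^n$ in the sense of viscosity solutions; that is, $w(\cdot,\omega)$ is lower semicontinuous, and $\kappa(\psi)(x)+f(x,w(x,\omega),\omega)+F^*\le 0$ whenever $\psi$ is $C^2$ near $x$ and $w(\cdot,\omega)-\psi$ has a local minimum at $x$. 2. The forced mean curvature flow of graphs that starts flat stays pinned below $w$: for every real $F\le F^*$, every $T>0$ and every continuous viscosity solution $u\colon\mathbb R^n\times[0,T)\to\mathbb R$ of $$\partial_t u=\sqrt{1+|\nabla u|^2}\,\bigl(\kappa(u)+f(x,u,\omega)+F\bigr),\qquad u(x,0)=0,$$ one has $u(x,t)\le w(x,\omega)$ for all $x\in\mathbb R^n$ and $t\in[0,T)$. -/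

import Mathlib

open MeasureTheory ProbabilityTheory Set
open scoped NNReal ENNReal

noncomputable section

namespace PinnedMCF

/-- The Euclidean space `ℝⁿ`. -/
abbrev Space (n : ℕ) : Type := EuclideanSpace ℝ (Fin n)

/-! ### The mean curvature operator for graphs -/

/-- The divergence `∑ i, ∂ᵢ Vᵢ` of a vector field on `ℝⁿ`. -/
def divergence {n : ℕ} (V : Space n → Space n) (x : Space n) : ℝ :=
  ∑ i, fderiv ℝ V x (EuclideanSpace.single i 1) i

/-- The area element `√(1 + |∇u|²)` of the graph of `u`. -/
def areaElement {n : ℕ} (u : Space n → ℝ) (x : Space n) : ℝ :=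
  Real.sqrt (1 + ‖gradient u x‖ ^ 2)

/-- The mean curvature `κ(u) = div (∇u / (n √(1 + |∇u|²)))` of the graph of `u`. -/
def meanCurvature {n : ℕ} (u : Space n → ℝ) (x : Space n) : ℝ :=
  divergence (fun z => ((n : ℝ) * areaElement u z)⁻¹ • gradient u z) x

/-! ### Obstacles -/

/-- The conditions on the shape `φ` of an individual obstacle: a smooth non-positive function
which vanishes outside the closed Euclidean ball of radius `r₁` and is at most `-1` on the
closed max-norm ball of radius `r₀`. -/
structure IsObstacleShape {n : ℕ} (φ : Space n × ℝ → ℝ) (r₀ r₁ : ℝ) : Prop where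
  smooth : ContDiff ℝ ((⊤ : ℕ∞) : WithTop ℕ∞) φ
  pos : 0 < r₀
  radius_lt : Real.sqrt n * r₀ < r₁
  nonpos : ∀ z, φ z ≤ 0
  eq_zero : ∀ (x : Space n) (y : ℝ), r₁ < Real.sqrt (‖x‖ ^ 2 + y ^ 2) → φ (x, y) = 0
  le_neg_one : ∀ (x : Space n) (y : ℝ), (∀ i, |x i| ≤ r₀) → |y| ≤ r₀ → φ (x, y) ≤ -1

/-- The number of indices `k` for which the point `p k ω` lies in `B`. -/
def pointCount {Ω X : Type*} (p : ℕ → Ω → X) (B : Set X) (ω : Ω) : ℝ≥0∞ :=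
  ∑' k, B.indicator (fun _ => 1) (p k ω)

/-- The points `p k`, `k ∈ ℕ`, form a Poisson process with intensity measure `μ`: the number of
points in a measurable set `B` of finite measure is Poisson distributed with mean `μ B`, and the
numbers of points in finitely many pairwise disjoint such sets are independent. -/
structure IsPoissonProcess {Ω X : Type*} [MeasurableSpace Ω] [MeasurableSpace X]
    (p : ℕ → Ω → X) (μ : Measure X) (P : Measure Ω) : Prop where
  measurable : ∀ k, Measurable (p k)
  law : ∀ B : Set X, MeasurableSet B → μ B ≠ ∞ →
    P.map (pointCount p B) = (poissonMeasure (μ B).toNNReal).map (fun m : ℕ => (m : ℝ≥0∞))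
  indep : ∀ (m : ℕ) (B : Fin m → Set X), (∀ j, MeasurableSet (B j)) → (∀ j, μ (B j) ≠ ∞) →
    Pairwise (fun i j => Disjoint (B i) (B j)) → iIndepFun (fun j => pointCount p (B j)) P

/-- The conditions on the distribution of the obstacle centres `p k = (x_k, y_k)` and of the
obstacle strengths `s k`: the centres form a Poisson process on `ℝⁿ × [r₁, ∞)` with intensity
`lam` (with respect to Lebesgue measure), and the strengths are iid, strictly positive and
independent of the centres. -/
structure IsObstacleField {n : ℕ} {Ω : Type*} [MeasurableSpace Ω] (P : Measure Ω)
    (p : ℕ → Ω → Space n × ℝ) (s : ℕ → Ω → ℝ) (r₁ : ℝ) (lam : ℝ≥0) : Prop where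
  intensity_pos : 0 < lam
  poisson : IsPoissonProcess p
    (lam • (volume : Measure (Space n × ℝ)).restrict {z | r₁ ≤ z.2}) P
  strength_measurable : ∀ k, Measurable (s k)
  strength_pos : ∀ k, ∀ᵐ ω ∂P, 0 < s k ω
  strength_indep : iIndepFun s P
  strength_identDistrib : ∀ k, IdentDistrib (s k) (s 0) P P
  indep : IndepFun (fun ω k => s k ω) (fun ω k => p k ω) P

/-- The heterogeneity `f(z) = ∑ i, s i * φ (z - p i)` for given centres `p` and strengths `s`.
If the centres are locally finite, only finitely many terms are non-zero. -/
def obstacleForce {n : ℕ} (φ : Space n × ℝ → ℝ) (p : ℕ → Space n × ℝ) (s : ℕ → ℝ)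
    (z : Space n × ℝ) : ℝ :=
  ∑' i, s i * φ (z - p i)

/-! ### Viscosity solutions -/

/-- `w` satisfies `0 ≥ κ(w) + f(x, w) + F` on `ℝⁿ` in the sense of viscosity solutions: it is
lower semicontinuous, and the inequality holds for the derivatives of every `C²` function that
touches `w` from below. -/
def IsStationarySupersolution {n : ℕ} (f : Space n × ℝ → ℝ) (F : ℝ) (w : Space n → ℝ) : Prop :=
  LowerSemicontinuous w ∧
    ∀ (ψ : Space n → ℝ) (x : Space n), ContDiffAt ℝ 2 ψ x →
      IsLocalMin (fun z => w z - ψ z) x → meanCurvature ψ x + f (x, w x) + F ≤ 0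

/-- `u` is a (continuous) viscosity solution on `ℝⁿ × [0, T)` of
`∂ₜu = √(1 + |∇u|²) (κ(u) + f(x, u) + F)`, `u(x, 0) = 0`. -/
structure IsForcedMCF {n : ℕ} (f : Space n × ℝ → ℝ) (F T : ℝ) (u : Space n → ℝ → ℝ) : Prop where
  continuousOn : ContinuousOn (fun q : Space n × ℝ => u q.1 q.2) (univ ×ˢ Ico 0 T)
  initial : ∀ x, u x 0 = 0
  subsolution : ∀ (ψ : Space n × ℝ → ℝ) (x : Space n) (t : ℝ), t ∈ Ioo 0 T →
    ContDiffAt ℝ 2 ψ (x, t) → IsLocalMax (fun q : Space n × ℝ => u q.1 q.2 - ψ q) (x, t) →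
    deriv (fun τ => ψ (x, τ)) t ≤ areaElement (fun z => ψ (z, t)) x *
      (meanCurvature (fun z => ψ (z, t)) x + f (x, u x t) + F)
  supersolution : ∀ (ψ : Space n × ℝ → ℝ) (x : Space n) (t : ℝ), t ∈ Ioo 0 T →
    ContDiffAt ℝ 2 ψ (x, t) → IsLocalMin (fun q : Space n × ℝ => u q.1 q.2 - ψ q) (x, t) →
    areaElement (fun z => ψ (z, t)) x *
      (meanCurvature (fun z => ψ (z, t)) x + f (x, u x t) + F) ≤ deriv (fun τ => ψ (x, τ)) t

end PinnedMCF

end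

/-!
The graph of `w` is pinned at suitable obstacles. An obstacle `k` with centre `(x_k, y_k)` and
strength at least `c` carries the *barrier* `P_k(x) = y_k + g(|x - x_k|²)`, where `g` is increasing,
bounded by `r₀ / 4`, and such that the mean curvature of `P_k` is at most `c / 2` for
`|x - x_k| ≤ r₀`, where the obstacle exerts a force of at most `-c`, and at most a negative constant
for `r₀ ≤ |x - x_k| ≤ 3 n d` (`exists_profile`). The profile approaches its limit at infinity like
`|x - x_k|⁻²ᵃ` with `n - 2 < 2 a < n`. The lower bound for `a` makes it strictly superharmonic. The
upper bound ensures that cells of side length `d` and height `H`, where `3 H` is the increment of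
the profile between the distances `n d` and `2 n d`, have arbitrarily large volume for large `d`,
and hence contain a strong obstacle with probability close to `1`.

For the Poisson process with independent marks, the probability that none of finitely many cells
contains a strong obstacle is bounded by a product (`IsPoissonProcess.measure_forall_mark_mem_le`;
only the law of the number of points in the union of the cells is used). Lipschitz percolation, by
counting shortest paths (`ae_exists_not_reach`), then yields a level surface: an integer height for
every index `z ∈ ℤⁿ` of a cube of side length `d`, which differs by at most `1` between indices
whose coordinates differ by at most `3 n + 1`, such that the cell over the cube at this height
contains a strong obstacle. Let `G` be the set of strong obstacles in these cells (`selected`) and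
let `w` be the pointwise minimum of the `P_k`, `k ∈ G`, with `|x - x_k| < 3 n d` (`envelope`). By
the choice of `H`, a barrier does not contribute to the minimum at distances of at least `2 n d`
from its centre (`isBarrierFamily_selected`). Hence a `C²` function that touches `w` from below
touches one of the `P_k` from below, and its curvature is at most that of `P_k`
(`meanCurvature_le_of_isLocalMin`), so that `w` is a stationary supersolution.

The comparison of the flow with `w` has to cope with the unbounded domain, with solutions of
arbitrary growth, and with a force that is neither monotone in the height nor uniformly Lipschitz.
Since the force is non-positive, logarithmic barriers, which blow up at the boundary of a
shrinking ball, bound the flow locally by its initial values (`IsForcedMCF.le_logBarrier`). So if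
`u ≤ w` at some time, then `u ≤ w + δ` for a short time that does not depend on the position. The
barriers `P_k` remain strict supersolutions when they are raised by up to `δ`; raising `P_k` by
`ε |x_k|` makes the comparison of `u` with all `P_k` a problem on a compact set, which gives `u ≤ w`
for this short time (`IsBarrierFamily.le_envelope_of_le_add`). Iteration gives `u ≤ w` throughout.
-/

namespace PinnedMCF

open Filter Topology

/-! ### The mean curvature operator in terms of gradient and Hessian -/

theorem sum_apply_single_mul {n : ℕ} (l : Space n →L[ℝ] ℝ) (v : Space n) :
    ∑ i, l (EuclideanSpace.single i 1) * v i = l v := by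
  conv_rhs => rw [← (EuclideanSpace.basisFun (Fin n) ℝ).sum_repr v]
  simp [mul_comm]

/-- The mean curvature in non-divergence form. `G` is the gradient field of `u` near `x` and `A`
is its derivative at `x`, so that the sum is the trace of the Hessian. -/
theorem meanCurvature_eq {n : ℕ} {u : Space n → ℝ} {G : Space n → Space n}
    {A : Space n →L[ℝ] Space n} {x : Space n}
    (hG : ∀ᶠ z in 𝓝 x, HasGradientAt u (G z) z) (hA : HasFDerivAt G A x) :
    meanCurvature u x = (∑ i, A (EuclideanSpace.single i 1) i
      - inner ℝ (G x) (A (G x)) / (1 + ‖G x‖ ^ 2)) / (n * Real.sqrt (1 + ‖G x‖ ^ 2)) := by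
  rcases Nat.eq_zero_or_pos n with rfl | hn
  · simp [meanCurvature, divergence]
  have hn' : (n : ℝ) ≠ 0 := by positivity
  have hev : (fun z => ((n : ℝ) * areaElement u z)⁻¹ • gradient u z) =ᶠ[𝓝 x]
      fun z => ((n : ℝ) * Real.sqrt (1 + ‖G z‖ ^ 2))⁻¹ • G z := by
    filter_upwards [hG] with z hz
    simp only [areaElement, hz.gradient]
  have hpos : 0 < 1 + ‖G x‖ ^ 2 := by positivity
  have hq : HasFDerivAt (fun z => 1 + ‖G z‖ ^ 2) (2 • (innerSL ℝ (G x)).comp A) x :=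
    hA.norm_sq.const_add 1
  have hphi : HasDerivAt (fun t : ℝ => ((n : ℝ) * Real.sqrt t)⁻¹)
      (-((n : ℝ) * (1 / (2 * Real.sqrt (1 + ‖G x‖ ^ 2)))) /
        ((n : ℝ) * Real.sqrt (1 + ‖G x‖ ^ 2)) ^ 2) (1 + ‖G x‖ ^ 2) :=
    ((Real.hasDerivAt_sqrt hpos.ne').const_mul (n : ℝ)).inv (by positivity)
  have hc := hphi.comp_hasFDerivAt x hq
  have hV := hc.smul hA
  have hs : 0 < Real.sqrt (1 + ‖G x‖ ^ 2) := Real.sqrt_pos.2 hpos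
  have hs2 : Real.sqrt (1 + ‖G x‖ ^ 2) ^ 2 = 1 + ‖G x‖ ^ 2 := Real.sq_sqrt hpos.le
  have hsum := sum_apply_single_mul ((innerSL ℝ (G x)).comp A) (G x)
  simp only [ContinuousLinearMap.comp_apply, innerSL_apply_apply] at hsum
  unfold meanCurvature divergence
  rw [hev.fderiv_eq]
  erw [hV.fderiv]
  simp only [add_apply, smul_apply,
    ContinuousLinearMap.smulRight_apply, PiLp.add_apply, PiLp.smul_apply, smul_eq_mul,
    ContinuousLinearMap.comp_apply, innerSL_apply_apply, Function.comp, Finset.sum_add_distrib,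
    ← Finset.mul_sum, nsmul_eq_mul, mul_assoc]
  rw [hsum]
  generalize Real.sqrt (1 + ‖G x‖ ^ 2) = a at *
  rw [← hs2]
  field_simp
  push_cast
  ring

theorem areaElement_eq {n : ℕ} {u : Space n → ℝ} {v x : Space n} (h : HasGradientAt u v x) :
    areaElement u x = Real.sqrt (1 + ‖v‖ ^ 2) := by
  rw [areaElement, h.gradient]

/-- For a non-negative quadratic form `q` the trace dominates `q(v) / |v|²`. -/
theorem inner_le_norm_sq_mul_trace {n : ℕ} {A : Space n →L[ℝ] Space n}
    (hA : ∀ e, 0 ≤ inner ℝ e (A e)) (v : Space n) :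
    inner ℝ v (A v) ≤ ‖v‖ ^ 2 * ∑ i, A (EuclideanSpace.single i 1) i := by
  set q : Fin n → Fin n → ℝ := fun i j => A (EuclideanSpace.single j 1) i with hq
  have key : ∀ i j, 0 ≤ v j ^ 2 * q i i - v i * v j * (q i j + q j i) + v i ^ 2 * q j j := by
    intro i j
    have := hA (v j • EuclideanSpace.single i 1 - v i • EuclideanSpace.single j 1)
    simp only [map_sub, map_smul, inner_sub_left, inner_sub_right, inner_smul_left,
      inner_smul_right, EuclideanSpace.inner_single_left] at this
    simp only [hq]
    simp at this
    linarith
  have hAv : inner ℝ v (A v) = ∑ i, ∑ j, v i * v j * q i j := by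
    have : A v = ∑ j, v j • A (EuclideanSpace.single j 1) := by
      conv_lhs => rw [← (EuclideanSpace.basisFun (Fin n) ℝ).sum_repr v]
      simp
    rw [PiLp.inner_apply]
    refine Finset.sum_congr rfl fun i _ => ?_
    rw [this]
    simp [Finset.sum_mul, hq]
    refine Finset.sum_congr rfl fun j _ => ?_
    ring
  have hsum : 0 ≤ ∑ i, ∑ j,
      (v j ^ 2 * q i i - v i * v j * (q i j + q j i) + v i ^ 2 * q j j) :=
    Finset.sum_nonneg fun i _ => Finset.sum_nonneg fun j _ => key i j
  have h1 : ∑ i, ∑ j, v j ^ 2 * q i i = ‖v‖ ^ 2 * ∑ i, q i i := by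
    rw [EuclideanSpace.real_norm_sq_eq, Finset.sum_mul_sum, Finset.sum_comm]
  have h2 : ∑ i, ∑ j, v i ^ 2 * q j j = ‖v‖ ^ 2 * ∑ i, q i i := by
    rw [EuclideanSpace.real_norm_sq_eq, Finset.sum_mul_sum]
  have h3 : ∑ i, ∑ j, v i * v j * q j i = ∑ i, ∑ j, v i * v j * q i j := by
    rw [Finset.sum_comm]
    refine Finset.sum_congr rfl fun i _ => Finset.sum_congr rfl fun j _ => by ring
  simp only [Finset.sum_add_distrib, Finset.sum_sub_distrib, mul_add, h1, h2, h3] at hsum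
  rw [hAv]
  linarith

/-- Necessary second order condition at a local minimum, in terms of the gradient field. -/
theorem inner_nonneg_of_isLocalMin {n : ℕ} {h : Space n → ℝ} {G : Space n → Space n}
    {A : Space n →L[ℝ] Space n} {x : Space n}
    (hG : ∀ᶠ z in 𝓝 x, HasGradientAt h (G z) z) (hA : HasFDerivAt G A x)
    (hmin : IsLocalMin h x) (e : Space n) : 0 ≤ inner ℝ e (A e) := by
  by_contra! hneg
  set l : ℝ → Space n := fun t => x + t • e with hl
  have hl0 : l 0 = x := by simp [hl]
  have hld : ∀ t, HasDerivAt l e t := fun t =>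
    (((hasDerivAt_id t).smul_const e).const_add x).congr_deriv (one_smul ℝ e)
  have hlt : Tendsto l (𝓝 0) (𝓝 x) := by
    have := (hld 0).continuousAt.tendsto
    rwa [hl0] at this
  have hd1 : ∀ᶠ t in 𝓝 (0 : ℝ), HasDerivAt (h ∘ l) (inner ℝ (G (l t)) e) t := by
    filter_upwards [hlt.eventually hG] with t ht
    simpa using ht.hasFDerivAt.comp_hasDerivAt t (hld t)
  have hde : deriv (h ∘ l) =ᶠ[𝓝 0] fun t => inner ℝ (G (l t)) e := by
    filter_upwards [hd1] with t ht using ht.deriv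
  have hd2 : HasDerivAt (fun t => inner ℝ (G (l t)) e) (inner ℝ (A e) e) 0 := by
    have h1 : HasDerivAt (fun t => G (l t)) (A e) 0 := by
      have : HasFDerivAt G A (l 0) := by rwa [hl0]
      exact this.comp_hasDerivAt 0 (hld 0)
    simpa using h1.inner ℝ (hasDerivAt_const (0 : ℝ) e)
  have hdd : deriv (deriv (h ∘ l)) 0 = inner ℝ (A e) e := by
    rw [hde.deriv_eq]; exact hd2.deriv
  have hmin' : IsLocalMin (h ∘ l) 0 := by
    have : ∀ᶠ z in 𝓝 x, h x ≤ h z := hmin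
    filter_upwards [hlt.eventually this] with t ht
    simpa [hl0] using ht
  have hmax' : IsLocalMax (h ∘ l) 0 := by
    refine isLocalMax_of_deriv_deriv_neg ?_ hmin'.deriv_eq_zero hd1.self_of_nhds.continuousAt
    rw [hdd, real_inner_comm]; exact hneg
  have hconst : (h ∘ l) =ᶠ[𝓝 0] fun _ => h x := by
    have h1 : ∀ᶠ t in 𝓝 (0 : ℝ), (h ∘ l) 0 ≤ (h ∘ l) t := hmin'
    have h2 : ∀ᶠ t in 𝓝 (0 : ℝ), (h ∘ l) t ≤ (h ∘ l) 0 := hmax'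
    filter_upwards [h1, h2] with t h1 h2
    rw [le_antisymm h2 h1]; simp [hl0]
  have hz : deriv (deriv (h ∘ l)) 0 = 0 := by
    rw [hconst.deriv.deriv_eq]; simp
  rw [hdd, real_inner_comm] at hz
  linarith

theorem ContDiffAt.exists_gradient {n : ℕ} {u : Space n → ℝ} {x : Space n}
    (h : ContDiffAt ℝ 2 u x) :
    (∀ᶠ z in 𝓝 x, HasGradientAt u (gradient u z) z) ∧
      HasFDerivAt (gradient u) (fderiv ℝ (gradient u) x) x := by
  constructor
  · filter_upwards [h.eventually (by simp)] with z hz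
    exact (hz.differentiableAt (by simp)).hasGradientAt
  · have h1 : DifferentiableAt ℝ (fderiv ℝ u) x :=
      (h.fderiv_right (m := 1) (by norm_num)).differentiableAt (by simp)
    have h2 : DifferentiableAt ℝ (gradient u) x :=
      ((InnerProductSpace.toDual ℝ (Space n)).symm.toContinuousLinearEquiv
        |>.differentiableAt).comp x h1
    exact h2.hasFDerivAt

/-- Ellipticity: if `ψ` touches `u` from below, its mean curvature is at most that of `u`. -/
theorem meanCurvature_le_of_isLocalMin {n : ℕ} {u ψ : Space n → ℝ} {x : Space n}
    (hu : ContDiffAt ℝ 2 u x) (hψ : ContDiffAt ℝ 2 ψ x)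
    (hmin : IsLocalMin (fun z => u z - ψ z) x) : meanCurvature ψ x ≤ meanCurvature u x := by
  obtain ⟨hu1, hu2⟩ := ContDiffAt.exists_gradient hu
  obtain ⟨hp1, hp2⟩ := ContDiffAt.exists_gradient hψ
  have hd : ∀ᶠ z in 𝓝 x, HasGradientAt (fun z => u z - ψ z) (gradient u z - gradient ψ z) z := by
    filter_upwards [hu1, hp1] with z h1 h2
    rw [hasGradientAt_iff_hasFDerivAt] at *
    rw [map_sub]
    exact h1.sub h2
  have hpsd := inner_nonneg_of_isLocalMin hd (hu2.sub hp2) hmin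
  have hg : gradient ψ x = gradient u x := by
    have h0 := hmin.hasFDerivAt_eq_zero hd.self_of_nhds.hasFDerivAt
    have : gradient u x - gradient ψ x = 0 :=
      (InnerProductSpace.toDual ℝ (Space n)).map_eq_zero_iff.1 h0
    exact (sub_eq_zero.1 this).symm
  have htr := inner_le_norm_sq_mul_trace hpsd (gradient u x)
  have htr0 : 0 ≤ ∑ i, (fderiv ℝ (gradient u) x - fderiv ℝ (gradient ψ) x)
      (EuclideanSpace.single i 1) i := by
    refine Finset.sum_nonneg fun i _ => ?_
    have := hpsd (EuclideanSpace.single i 1)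
    rw [EuclideanSpace.inner_single_left] at this
    simpa using this
  rw [meanCurvature_eq hu1 hu2, meanCurvature_eq hp1 hp2, hg]
  have hpos : 0 < 1 + ‖gradient u x‖ ^ 2 := by positivity
  refine div_le_div_of_nonneg_right ?_ (by positivity)
  simp only [sub_apply, inner_sub_right, PiLp.sub_apply,
    Finset.sum_sub_distrib] at htr htr0
  rw [← sub_nonneg]
  have : (inner ℝ (gradient u x) (fderiv ℝ (gradient u) x (gradient u x))
      - inner ℝ (gradient u x) (fderiv ℝ (gradient ψ) x (gradient u x))) / (1 + ‖gradient u x‖ ^ 2)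
      ≤ ∑ i, fderiv ℝ (gradient u) x (EuclideanSpace.single i 1) i
        - ∑ i, fderiv ℝ (gradient ψ) x (EuclideanSpace.single i 1) i := by
    rw [div_le_iff₀ hpos]
    linarith
  rw [sub_div] at this
  linarith

/-! ### Radial functions -/

theorem hasGradientAt_radial {n : ℕ} {g : ℝ → ℝ} {g' : ℝ} {c x : Space n}
    (h : HasDerivAt g g' (‖x - c‖ ^ 2)) :
    HasGradientAt (fun z => g (‖z - c‖ ^ 2)) ((2 * g') • (x - c)) x := by
  rw [hasGradientAt_iff_hasFDerivAt]
  have h1 : HasFDerivAt (fun z : Space n => ‖z - c‖ ^ 2)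
      (2 • (innerSL ℝ (x - c)).comp (ContinuousLinearMap.id ℝ (Space n))) x :=
    ((hasFDerivAt_id x).sub_const c).norm_sq
  refine (h.comp_hasFDerivAt x h1).congr_fderiv ?_
  ext v
  simp
  ring

/-- The mean curvature of a radial function `z ↦ g (|z - c|²)`. -/
theorem meanCurvature_radial {n : ℕ} {g g₁ : ℝ → ℝ} {g₂ : ℝ} {c x : Space n}
    (h1 : ∀ᶠ t in 𝓝 (‖x - c‖ ^ 2), HasDerivAt g (g₁ t) t)
    (h2 : HasDerivAt g₁ g₂ (‖x - c‖ ^ 2)) :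
    areaElement (fun z => g (‖z - c‖ ^ 2)) x
        = Real.sqrt (1 + 4 * g₁ (‖x - c‖ ^ 2) ^ 2 * ‖x - c‖ ^ 2) ∧
    meanCurvature (fun z => g (‖z - c‖ ^ 2)) x = (2 * (n - 1) * g₁ (‖x - c‖ ^ 2) +
      (2 * g₁ (‖x - c‖ ^ 2) + 4 * g₂ * ‖x - c‖ ^ 2)
        / (1 + 4 * g₁ (‖x - c‖ ^ 2) ^ 2 * ‖x - c‖ ^ 2))
      / (n * Real.sqrt (1 + 4 * g₁ (‖x - c‖ ^ 2) ^ 2 * ‖x - c‖ ^ 2)) := by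
  set G : Space n → Space n := fun z => (2 * g₁ (‖z - c‖ ^ 2)) • (z - c) with hGdef
  have hcont : Tendsto (fun z : Space n => ‖z - c‖ ^ 2) (𝓝 x) (𝓝 (‖x - c‖ ^ 2)) := by
    have : Continuous fun z : Space n => ‖z - c‖ ^ 2 := by fun_prop
    exact this.tendsto x
  have hG : ∀ᶠ z in 𝓝 x, HasGradientAt (fun z => g (‖z - c‖ ^ 2)) (G z) z := by
    filter_upwards [hcont.eventually h1] with z hz using hasGradientAt_radial hz
  have hsq : HasFDerivAt (fun z : Space n => ‖z - c‖ ^ 2)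
      (2 • (innerSL ℝ (x - c)).comp (ContinuousLinearMap.id ℝ (Space n))) x :=
    ((hasFDerivAt_id x).sub_const c).norm_sq
  have hA := ((h2.comp_hasFDerivAt x hsq).const_mul 2).smul ((hasFDerivAt_id x).sub_const c)
  have hnorm : ‖G x‖ ^ 2 = 4 * g₁ (‖x - c‖ ^ 2) ^ 2 * ‖x - c‖ ^ 2 := by
    simp only [hGdef, norm_smul, mul_pow, Real.norm_eq_abs, sq_abs]
    ring
  refine ⟨by rw [areaElement_eq hG.self_of_nhds, hnorm], ?_⟩
  rw [meanCurvature_eq hG hA, hnorm]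
  congr 1
  have htr : ∑ i, (x - c) i * (x - c) i = ‖x - c‖ ^ 2 := by
    rw [EuclideanSpace.real_norm_sq_eq]; simp [sq]
  have hin : inner ℝ (x - c) (x - c) = ‖x - c‖ ^ 2 := real_inner_self_eq_norm_sq _
  have hpos : 0 < 1 + 4 * g₁ (‖x - c‖ ^ 2) ^ 2 * ‖x - c‖ ^ 2 := by positivity
  simp only [Function.comp, hGdef, add_apply, smul_apply,
    ContinuousLinearMap.smulRight_apply, PiLp.add_apply, PiLp.smul_apply, smul_eq_mul,
    ContinuousLinearMap.comp_apply, innerSL_apply_apply, Finset.sum_add_distrib,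
    ContinuousLinearMap.id_apply, inner_add_right, inner_smul_left, inner_smul_right, hin,
    EuclideanSpace.inner_single_right, nsmul_eq_mul, id_eq]
  simp only [PiLp.single_apply, if_true, mul_one, one_mul, Finset.sum_const, Finset.card_univ,
    Fintype.card_fin, nsmul_eq_mul, conj_trivial, mul_assoc, ← Finset.mul_sum, htr]
  generalize ‖x - c‖ ^ 2 = s at *
  generalize g₁ s = a at *
  have hne : 1 + 4 * (a ^ 2 * s) ≠ 0 := by rw [← mul_assoc]; exact hpos.ne'
  push_cast
  obtain ⟨D, hD⟩ : ∃ D, D = 1 + 4 * (a ^ 2 * s) := ⟨_, rfl⟩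
  rw [← hD] at hne ⊢
  field_simp
  rw [hD]
  ring

/-! ### Evolution: a local bound for solutions -/

theorem areaElement_pos {n : ℕ} (u : Space n → ℝ) (x : Space n) : 0 < areaElement u x :=
  Real.sqrt_pos.2 (by positivity)

theorem meanCurvature_add_const {n : ℕ} (u : Space n → ℝ) (b : ℝ) (x : Space n) :
    meanCurvature (fun z => u z + b) x = meanCurvature u x := by
  have h : gradient (fun z => u z + b) = gradient u := by
    funext z
    simp only [gradient, fderiv_add_const]
  unfold meanCurvature areaElement
  rw [h]

/-- The speed of a logarithmic barrier whose domain shrinks at rate `M` in the variable `|x|²`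
exceeds the normal speed of the forced flow. -/
theorem logBarrier_speed {n : ℕ} (hn : 1 ≤ n) {c x : Space n} {b R m F Fs M : ℝ} (hR : 0 < R)
    (hs : ‖x - c‖ ^ 2 + m < R ^ 2) (hm : 0 ≤ m) (hF : F ≤ Fs) (hFs : 0 < Fs)
    (hM : 2 + 2 * R * Fs + (1 + Fs) * R ^ 2 < M) :
    areaElement (fun z => b - Real.log (R ^ 2 - (‖z - c‖ ^ 2 + m))) x *
      (meanCurvature (fun z => b - Real.log (R ^ 2 - (‖z - c‖ ^ 2 + m))) x + F)
      < M * (R ^ 2 - (‖x - c‖ ^ 2 + m))⁻¹ := by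
  have hn' : (1 : ℝ) ≤ n := by exact_mod_cast hn
  have hev : ∀ᶠ t in 𝓝 (‖x - c‖ ^ 2), 0 < R ^ 2 - (t + m) := by
    have hc : Continuous fun t : ℝ => R ^ 2 - (t + m) := by fun_prop
    exact (hc.tendsto _).eventually (lt_mem_nhds (by linarith))
  have hd : ∀ t, HasDerivAt (fun t : ℝ => R ^ 2 - (t + m)) (-1) t := fun t =>
    ((hasDerivAt_id t).add_const m).const_sub (R ^ 2)
  have h1 : ∀ᶠ t in 𝓝 (‖x - c‖ ^ 2), HasDerivAt (fun t => b - Real.log (R ^ 2 - (t + m)))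
      ((fun t => (R ^ 2 - (t + m))⁻¹) t) t := by
    filter_upwards [hev] with t ht
    exact (((hd t).log ht.ne').const_sub b).congr_deriv (by field_simp)
  have h2 : HasDerivAt (fun t => (R ^ 2 - (t + m))⁻¹)
      ((R ^ 2 - (‖x - c‖ ^ 2 + m))⁻¹ ^ 2) (‖x - c‖ ^ 2) :=
    ((hd _).inv hev.self_of_nhds.ne').congr_deriv (by field_simp)
  obtain ⟨e1, e2⟩ := meanCurvature_radial (n := n) h1 h2
  have hxR : ‖x - c‖ < R := lt_of_pow_lt_pow_left₀ 2 hR.le (by linarith)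
  rw [e1, e2]
  have hsd : ‖x - c‖ ^ 2 = ‖x - c‖ * ‖x - c‖ := sq _
  have hp0 := norm_nonneg (x - c)
  have hg0 : (R ^ 2)⁻¹ ≤ (R ^ 2 - (‖x - c‖ ^ 2 + m))⁻¹ :=
    inv_anti₀ (by linarith) (by nlinarith)
  generalize (R ^ 2 - (‖x - c‖ ^ 2 + m))⁻¹ = g at *
  generalize ‖x - c‖ = p at *
  have hg : 0 < g := lt_of_lt_of_le (by positivity) hg0
  have hgR : 1 ≤ g * R ^ 2 := by
    have := mul_le_mul_of_nonneg_right hg0 (sq_nonneg R)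
    rwa [inv_mul_cancel₀ (by positivity)] at this
  have hD : 0 < 1 + 4 * g ^ 2 * p ^ 2 := by positivity
  have hroot : Real.sqrt (1 + 4 * g ^ 2 * p ^ 2) ≤ 1 + 2 * g * R := by
    rw [Real.sqrt_le_left (by positivity)]
    have : g ^ 2 * p ^ 2 ≤ g ^ 2 * R ^ 2 := by gcongr
    nlinarith [mul_pos hg hR]
  have hq : 0 < Real.sqrt (1 + 4 * g ^ 2 * p ^ 2) := Real.sqrt_pos.2 hD
  have hfrac : (2 * g + 4 * g ^ 2 * p ^ 2) / (1 + 4 * g ^ 2 * p ^ 2) ≤ 2 * g + 1 := by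
    rw [div_le_iff₀ hD]
    nlinarith [mul_pos hg hD, mul_nonneg hg.le (mul_nonneg (sq_nonneg g) (sq_nonneg p))]
  have hcurv : (2 * ((n : ℝ) - 1) * g + (2 * g + 4 * g ^ 2 * p ^ 2) / (1 + 4 * g ^ 2 * p ^ 2)) / n
      ≤ 2 * g + 1 := by
    rw [div_le_iff₀ (by positivity)]
    nlinarith
  have hFle : Real.sqrt (1 + 4 * g ^ 2 * p ^ 2) * F ≤ (1 + 2 * g * R) * Fs :=
    (mul_le_mul_of_nonneg_left hF hq.le).trans (mul_le_mul_of_nonneg_right hroot hFs.le)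
  have hsplit : Real.sqrt (1 + 4 * g ^ 2 * p ^ 2) *
      ((2 * ((n : ℝ) - 1) * g + (2 * g + 4 * g ^ 2 * p ^ 2) / (1 + 4 * g ^ 2 * p ^ 2)) /
        (n * Real.sqrt (1 + 4 * g ^ 2 * p ^ 2)) + F) =
      (2 * ((n : ℝ) - 1) * g + (2 * g + 4 * g ^ 2 * p ^ 2) / (1 + 4 * g ^ 2 * p ^ 2)) / n
        + Real.sqrt (1 + 4 * g ^ 2 * p ^ 2) * F := by
    generalize (2 * g + 4 * g ^ 2 * p ^ 2) / (1 + 4 * g ^ 2 * p ^ 2) = y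
    field_simp
  rw [hsplit]
  have : (2 + 2 * R * Fs + (1 + Fs) * R ^ 2) * g < M * g := mul_lt_mul_of_pos_right hM hg
  nlinarith

/-- A bound for the flow at `x₀` that only uses the initial values in the ball of radius `R`: the
barrier `c₀ - log (1 - (|x - x₀|² + M (t - a)) / R²)` blows up at the boundary of its domain, so no
assumption on the growth of the solution is needed. -/
theorem IsForcedMCF.le_logBarrier {n : ℕ} (hn : 1 ≤ n) {f : Space n × ℝ → ℝ} {F Fs T : ℝ}
    {u : Space n → ℝ → ℝ} (hu : IsForcedMCF f F T u) (hf : ∀ z, f z ≤ 0) (hF : F ≤ Fs)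
    (hFs : 0 < Fs) {R M a c₀ : ℝ} (hR : 0 < R) (hM : 2 + 2 * R * Fs + (1 + Fs) * R ^ 2 < M)
    (ha : 0 ≤ a) (haT : a + R ^ 2 / M < T) {x₀ : Space n}
    (hinit : ∀ x, ‖x - x₀‖ ≤ R → u x a ≤ c₀) {t : ℝ} (hat : a ≤ t) (ht : M * (t - a) < R ^ 2) :
    u x₀ t ≤ c₀ + Real.log (R ^ 2) - Real.log (R ^ 2 - M * (t - a)) := by
  by_contra! hcon
  have hM0 : 0 < M := lt_trans (by positivity) hM
  set σ : Space n × ℝ → ℝ := fun q => ‖q.1 - x₀‖ ^ 2 + M * (q.2 - a) with hσ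
  have hσc : Continuous σ := by fun_prop
  set ψ : Space n × ℝ → ℝ := fun q => c₀ + Real.log (R ^ 2) - Real.log (R ^ 2 - σ q) with hψ
  have hσM : ∀ q, M * (q.2 - a) ≤ σ q := fun q => by
    simp only [hσ]
    linarith [sq_nonneg ‖q.1 - x₀‖]
  have htime : ∀ q, a ≤ q.2 → σ q < R ^ 2 → q.2 < T := by
    intro q hq1 hq2
    refine lt_trans ?_ haT
    have : M * (q.2 - a) < R ^ 2 := lt_of_le_of_lt (hσM q) hq2
    have : q.2 - a < R ^ 2 / M := by rwa [lt_div_iff₀' hM0]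
    linarith
  have hspace : ∀ q, a ≤ q.2 → σ q ≤ R ^ 2 → ‖q.1 - x₀‖ ≤ R := by
    intro q hq1 hq2
    refine le_of_sq_le_sq ?_ hR.le
    have : 0 ≤ M * (q.2 - a) := mul_nonneg hM0.le (by linarith)
    simp only [hσ] at hq2
    linarith
  -- an upper bound for the solution on the closure of the domain of the barrier
  obtain ⟨B, hB⟩ : ∃ B, ∀ q : Space n × ℝ, a ≤ q.2 → σ q < R ^ 2 → u q.1 q.2 ≤ B := by
    have hK : IsCompact (Metric.closedBall x₀ R ×ˢ Icc a (a + R ^ 2 / M)) :=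
      (isCompact_closedBall x₀ R).prod isCompact_Icc
    have hc : ContinuousOn (fun q : Space n × ℝ => u q.1 q.2)
        (Metric.closedBall x₀ R ×ˢ Icc a (a + R ^ 2 / M)) :=
      hu.continuousOn.mono fun q hq => ⟨mem_univ _, ha.trans hq.2.1, lt_of_le_of_lt hq.2.2 haT⟩
    obtain ⟨B, hB⟩ := hK.bddAbove_image hc
    refine ⟨B, fun q h1 h2 => hB ⟨q, ⟨?_, h1, ?_⟩, rfl⟩⟩
    · rw [Metric.mem_closedBall, dist_eq_norm]; exact hspace q h1 h2.le
    · have : M * (q.2 - a) < R ^ 2 := lt_of_le_of_lt (hσM q) h2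
      have : q.2 - a < R ^ 2 / M := by rwa [lt_div_iff₀' hM0]
      linarith
  -- where `u > ψ`, the barrier is below `B`, hence its argument `σ` is at most `S`
  set S : ℝ := R ^ 2 - R ^ 2 * Real.exp (c₀ - B) with hS
  have hSR : S < R ^ 2 := by
    have : 0 < R ^ 2 * Real.exp (c₀ - B) := by positivity
    linarith
  have hbound : ∀ q, a ≤ q.2 → σ q < R ^ 2 → 0 < u q.1 q.2 - ψ q → σ q < S := by
    intro q h1 h2 h3
    have h4 := hB q h1 h2
    have h5 : Real.log (R ^ 2 * Real.exp (c₀ - B)) < Real.log (R ^ 2 - σ q) := by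
      rw [Real.log_mul (by positivity) (Real.exp_pos _).ne', Real.log_exp]
      simp only [hψ] at h3
      linarith
    have := (Real.log_lt_log_iff (by positivity) (by linarith)).1 h5
    simp only [hS]; linarith
  set K : Set (Space n × ℝ) := {q | a ≤ q.2 ∧ σ q ≤ S} with hKdef
  have hKc : IsCompact K := by
    refine IsCompact.of_isClosed_subset
      ((isCompact_closedBall x₀ R).prod (isCompact_Icc (a := a) (b := T))) ?_ ?_
    · exact (isClosed_le continuous_const continuous_snd).inter
        (isClosed_le hσc continuous_const)
    · rintro q ⟨h1, h2⟩
      refine ⟨?_, h1, (htime q h1 (h2.trans_lt hSR)).le⟩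
      rw [Metric.mem_closedBall, dist_eq_norm]
      exact hspace q h1 (h2.trans hSR.le)
  have hψc : ContinuousOn ψ K := by
    refine continuousOn_const.sub (ContinuousOn.log (by fun_prop) fun q hq => ?_)
    have := hq.2
    linarith
  have huc : ContinuousOn (fun q : Space n × ℝ => u q.1 q.2) K :=
    hu.continuousOn.mono fun q hq =>
      ⟨mem_univ _, ha.trans hq.1, htime q hq.1 (hq.2.trans_lt hSR)⟩
  have hσt : σ (x₀, t) = M * (t - a) := by simp [hσ]
  have hpos0 : 0 < u x₀ t - ψ (x₀, t) := by simp only [hψ, hσt]; linarith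
  have hmem : (x₀, t) ∈ K := ⟨hat, (hbound (x₀, t) hat (by rwa [hσt]) hpos0).le⟩
  obtain ⟨⟨x, τ⟩, hqK, hqmax⟩ := hKc.exists_isMaxOn ⟨_, hmem⟩ (huc.sub hψc)
  have hpos : 0 < u x τ - ψ (x, τ) := hpos0.trans_le (hqmax hmem)
  have hqR : σ (x, τ) < R ^ 2 := hqK.2.trans_lt hSR
  have hqS : σ (x, τ) < S := hbound (x, τ) hqK.1 hqR hpos
  have hτa : a < τ := by
    refine lt_of_le_of_ne hqK.1 fun h => ?_
    have h1 := hinit x (hspace (x, τ) hqK.1 hqR.le)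
    have h2 : Real.log (R ^ 2 - σ (x, τ)) ≤ Real.log (R ^ 2) := by
      refine Real.log_le_log (by linarith) ?_
      simp only [hσ, ← h, sub_self, mul_zero, add_zero]
      nlinarith [sq_nonneg ‖x - x₀‖]
    simp only [hψ] at hpos
    rw [← h] at hpos h2
    linarith
  have hnear : ∀ᶠ q in 𝓝 (x, τ), q ∈ K := by
    have h1 : ∀ᶠ q : Space n × ℝ in 𝓝 (x, τ), a < q.2 :=
      (continuous_snd.tendsto (x, τ)).eventually (lt_mem_nhds hτa)
    have h2 : ∀ᶠ q : Space n × ℝ in 𝓝 (x, τ), σ q < S :=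
      (hσc.tendsto (x, τ)).eventually (gt_mem_nhds hqS)
    filter_upwards [h1, h2] with q h1 h2 using ⟨h1.le, h2.le⟩
  have hloc : IsLocalMax (fun q : Space n × ℝ => u q.1 q.2 - ψ q) (x, τ) := by
    filter_upwards [hnear] with q hq using hqmax hq
  have hσd : ContDiff ℝ 2 σ := by
    have h1 : ContDiff ℝ 2 fun q : Space n × ℝ => ‖q.1 - x₀‖ ^ 2 :=
      (contDiff_fst.sub contDiff_const).norm_sq ℝ
    exact h1.add (contDiff_const.mul (contDiff_snd.sub contDiff_const))
  have hψd : ContDiffAt ℝ 2 ψ (x, τ) :=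
    contDiffAt_const.sub ((contDiffAt_const.sub hσd.contDiffAt).log (by linarith))
  have hsub := hu.subsolution ψ x τ
    ⟨ha.trans_lt hτa, htime (x, τ) hqK.1 hqR⟩ hψd hloc
  have hder : deriv (fun s => ψ (x, s)) τ = M * (R ^ 2 - σ (x, τ))⁻¹ := by
    have h1 : HasDerivAt (fun s => R ^ 2 - σ (x, s)) (-M) τ := by
      have := ((((hasDerivAt_id τ).sub_const a).const_mul M).const_add (‖x - x₀‖ ^ 2)).const_sub
        (R ^ 2)
      exact this.congr_deriv (by simp)
    have h2 := (h1.log (by linarith)).const_sub (c₀ + Real.log (R ^ 2))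
    refine h2.deriv.trans ?_
    field_simp
  have hspeed := logBarrier_speed hn (c := x₀) (x := x) (b := c₀ + Real.log (R ^ 2))
    (m := M * (τ - a)) hR hqR (mul_nonneg hM0.le (by linarith)) hF hFs hM
  rw [hder] at hsub
  have hfx := mul_nonneg (areaElement_pos (fun z => ψ (z, τ)) x).le (neg_nonneg.2 (hf (x, u x τ)))
  simp only [hψ, hσ] at hsub hfx
  nlinarith

/-! ### Locally finite families of barriers and their envelope -/

/-- A locally finite family of `C²` barriers `P k`, `k ∈ G`, for the heterogeneity `f` and the
driving force `F`. The barrier `P k` is a strict supersolution on the ball of radius `3ρ` about its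
centre `X k`, and remains one if it is raised by at most `δ`. The balls of radius `ρ` cover the
space, and at distance between `2ρ` and `3ρ` from its centre a barrier lies above another one,
by a margin of at least `η`, so that it does not contribute to the minimum there. -/
structure IsBarrierFamily {n : ℕ} {ι : Type*} (G : Set ι) (X : ι → Space n)
    (P : ι → Space n → ℝ) (f : Space n × ℝ → ℝ) (F δ ρ η : ℝ) : Prop where
  force_pos : 0 < F
  raise_pos : 0 < δ
  radius_pos : 0 < ρ
  margin_pos : 0 < η
  force_nonpos : ∀ z, f z ≤ 0
  contDiff : ∀ k x, ContDiffAt ℝ 2 (P k) x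
  nonneg : ∀ k ∈ G, ∀ x, 0 ≤ P k x
  supersolution : ∀ k ∈ G, ∀ x, ‖x - X k‖ < 3 * ρ → ∀ y, P k x ≤ y → y ≤ P k x + δ →
    meanCurvature (P k) x + f (x, y) + F < 0
  oscillation : ∀ k x x', P k x ≤ P k x' + δ / 2
  cover : ∀ x, ∃ k ∈ G, ‖x - X k‖ ≤ ρ
  gap : ∀ k ∈ G, ∀ x, 2 * ρ ≤ ‖x - X k‖ → ‖x - X k‖ < 3 * ρ →
    ∃ k' ∈ G, ‖x - X k'‖ ≤ ρ ∧ P k' x + η ≤ P k x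
  locallyFinite : ∀ r, {k | k ∈ G ∧ ‖X k‖ ≤ r}.Finite

/-- The minimum of those barriers `P k`, `k ∈ G`, whose centres have distance less than `R` from
`x`. It is computed in `ℝ≥0∞`, where the remaining barriers are given the value `∞`. -/
noncomputable def envelope {n : ℕ} {ι : Type*} (G : Set ι) (X : ι → Space n)
    (P : ι → Space n → ℝ) (R : ℝ) (x : Space n) : ℝ :=
  (⨅ k, ⨅ _ : k ∈ G ∧ ‖x - X k‖ < R, ENNReal.ofReal (P k x)).toReal

theorem envelope_nonneg {n : ℕ} {ι : Type*} (G : Set ι) (X : ι → Space n) (P : ι → Space n → ℝ)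
    (R : ℝ) (x : Space n) : 0 ≤ envelope G X P R x :=
  ENNReal.toReal_nonneg

namespace IsBarrierFamily

variable {n : ℕ} {ι : Type*} {G : Set ι} {X : ι → Space n} {P : ι → Space n → ℝ}
  {f : Space n × ℝ → ℝ} {F δ ρ η : ℝ}

theorem finite_near (h : IsBarrierFamily G X P f F δ ρ η) (x : Space n) (r : ℝ) :
    {k | k ∈ G ∧ ‖x - X k‖ < r}.Finite := by
  refine (h.locallyFinite (‖x‖ + r)).subset fun k hk => ⟨hk.1, ?_⟩
  have h1 : ‖X k‖ ≤ ‖x‖ + ‖x - X k‖ := by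
    rw [← norm_neg (x - X k), neg_sub]
    simpa using norm_add_le x (X k - x)
  linarith [hk.2]

theorem exists_minimal (h : IsBarrierFamily G X P f F δ ρ η) (x : Space n) :
    ∃ k ∈ G, ‖x - X k‖ < 2 * ρ ∧ ∀ k' ∈ G, ‖x - X k'‖ < 3 * ρ → P k x ≤ P k' x := by
  have hρ := h.radius_pos
  obtain ⟨k₀, hk₀, hx₀⟩ := h.cover x
  obtain ⟨k, ⟨hk, hkx⟩, hmin⟩ := Set.exists_min_image _ (fun k => P k x) (h.finite_near x (3 * ρ))
    ⟨k₀, hk₀, by linarith⟩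
  refine ⟨k, hk, ?_, fun k' hk' hx' => hmin k' ⟨hk', hx'⟩⟩
  by_contra! hfar
  obtain ⟨k', hk', hx', hlt⟩ := h.gap k hk x hfar hkx
  have := hmin k' ⟨hk', by linarith⟩
  have := h.margin_pos
  linarith

/-- At each point the envelope is attained by a barrier with a nearby centre. -/
theorem envelope_spec (h : IsBarrierFamily G X P f F δ ρ η) (x : Space n) :
    ∃ k ∈ G, ‖x - X k‖ < 2 * ρ ∧ envelope G X P (3 * ρ) x = P k x := by
  obtain ⟨k, hk, hkx, hmin⟩ := h.exists_minimal x
  have hρ := h.radius_pos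
  refine ⟨k, hk, hkx, ?_⟩
  have : (⨅ k, ⨅ _ : k ∈ G ∧ ‖x - X k‖ < 3 * ρ, ENNReal.ofReal (P k x))
      = ENNReal.ofReal (P k x) :=
    le_antisymm (iInf₂_le k ⟨hk, by linarith⟩)
      (le_iInf₂ fun k' hk' => ENNReal.ofReal_le_ofReal (hmin k' hk'.1 hk'.2))
  rw [envelope, this, ENNReal.toReal_ofReal (h.nonneg k hk x)]

theorem envelope_le (h : IsBarrierFamily G X P f F δ ρ η) {x : Space n} {k : ι} (hk : k ∈ G)
    (hx : ‖x - X k‖ < 3 * ρ) : envelope G X P (3 * ρ) x ≤ P k x := by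
  refine ENNReal.toReal_le_of_le_ofReal (h.nonneg k hk x) ?_
  exact iInf₂_le k ⟨hk, hx⟩

theorem envelope_osc (h : IsBarrierFamily G X P f F δ ρ η) {x x' : Space n} (hx : ‖x - x'‖ ≤ ρ) :
    envelope G X P (3 * ρ) x ≤ envelope G X P (3 * ρ) x' + δ / 2 := by
  obtain ⟨k, hk, hkx, heq⟩ := h.envelope_spec x'
  rw [heq]
  have : ‖x - X k‖ ≤ ‖x - x'‖ + ‖x' - X k‖ := norm_sub_le_norm_sub_add_norm_sub x x' (X k)
  exact (h.envelope_le hk (by linarith)).trans (h.oscillation k x x')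

/-- The envelope is a stationary viscosity supersolution: a function touching it from below also
touches one of the barriers. -/
theorem envelope_supersolution (h : IsBarrierFamily G X P f F δ ρ η) :
    IsStationarySupersolution f F (envelope G X P (3 * ρ)) := by
  have hρ := h.radius_pos
  have hball : ∀ (x : Space n) (k : ι), ‖x - X k‖ < 3 * ρ → ∀ᶠ z in 𝓝 x, ‖z - X k‖ < 3 * ρ := by
    intro x k hk
    have hc : Continuous fun z : Space n => ‖z - X k‖ := by fun_prop
    exact (hc.tendsto x).eventually (gt_mem_nhds hk)
  constructor
  · intro x y hy
    have hfin := h.finite_near x (3 * ρ)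
    have h1 : ∀ᶠ z in 𝓝 x, ∀ k ∈ {k | k ∈ G ∧ ‖x - X k‖ < 3 * ρ}, y < P k z := by
      rw [Filter.eventually_all_finite hfin]
      intro k hk
      exact (h.contDiff k x).continuousAt.eventually
        (lt_mem_nhds (hy.trans_le (h.envelope_le hk.1 hk.2)))
    filter_upwards [h1, Metric.ball_mem_nhds x hρ] with z hz hzx
    obtain ⟨k, hk, hkz, heq⟩ := h.envelope_spec z
    rw [Metric.mem_ball, dist_comm, dist_eq_norm] at hzx
    have : ‖x - X k‖ ≤ ‖x - z‖ + ‖z - X k‖ := norm_sub_le_norm_sub_add_norm_sub x z (X k)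
    simp only [heq]
    exact hz k ⟨hk, by linarith⟩
  · intro ψ x hψ hmin
    obtain ⟨k, hk, hkx, heq⟩ := h.envelope_spec x
    have hk3 : ‖x - X k‖ < 3 * ρ := by linarith
    have hmin' : IsLocalMin (fun z => P k z - ψ z) x := by
      have hmin : ∀ᶠ z in 𝓝 x, envelope G X P (3 * ρ) x - ψ x ≤ envelope G X P (3 * ρ) z - ψ z :=
        hmin
      filter_upwards [hmin, hball x k hk3] with z h1 h2
      have := h.envelope_le hk h2
      linarith
    have h1 := meanCurvature_le_of_isLocalMin (h.contDiff k x) hψ hmin'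
    have h2 := h.supersolution k hk x hk3 _ le_rfl (by linarith [h.raise_pos])
    rw [heq]
    linarith

/-! ### Comparison of the flow with the envelope -/

set_option maxHeartbeats 400000 in
/-- Comparison on a time interval on which the solution is known to exceed the envelope by at most
`δ`. Instead of the difference with the envelope itself, the differences with the single barriers
are maximized, with constants `ε |X k|` added to the barriers; these make the problem compact
without changing the curvature of the barriers. -/
theorem le_envelope_of_le_add (h : IsBarrierFamily G X P f F δ ρ η) {F' T a b : ℝ}
    {u : Space n → ℝ → ℝ} (hu : IsForcedMCF f F' T u) (hF : F' ≤ F) (ha : 0 ≤ a) (hb : b ≤ T)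
    (hinit : ∀ x, u x a ≤ envelope G X P (3 * ρ) x)
    (hbound : ∀ x, ∀ t ∈ Ico a b, u x t ≤ envelope G X P (3 * ρ) x + δ) :
    ∀ x, ∀ t ∈ Ico a b, u x t ≤ envelope G X P (3 * ρ) x := by
  intro x₀ t₀ ht₀
  by_contra! hcon
  have hρ := h.radius_pos
  have hδ := h.raise_pos
  have hη := h.margin_pos
  obtain ⟨k₀, hk₀, hx₀, heq⟩ := h.envelope_spec x₀
  rw [heq] at hcon
  have hbt : 0 < b - t₀ := by linarith [ht₀.2]
  -- the two penalization parameters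
  obtain ⟨ε, hε, hεη, hεk⟩ : ∃ ε > 0, ε * (5 * ρ) < η ∧
      ε * ‖X k₀‖ < (u x₀ t₀ - P k₀ x₀) / 2 := by
    have h1 : ∀ᶠ ε in 𝓝[>] (0 : ℝ), ε * (5 * ρ) < η := by
      have hc : Continuous fun ε : ℝ => ε * (5 * ρ) := by fun_prop
      exact nhdsWithin_le_nhds ((hc.tendsto 0).eventually (gt_mem_nhds (by simpa using hη)))
    have h2 : ∀ᶠ ε in 𝓝[>] (0 : ℝ), ε * ‖X k₀‖ < (u x₀ t₀ - P k₀ x₀) / 2 := by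
      have hc : Continuous fun ε : ℝ => ε * ‖X k₀‖ := by fun_prop
      exact nhdsWithin_le_nhds ((hc.tendsto 0).eventually (gt_mem_nhds (by simp; linarith)))
    obtain ⟨ε, hε⟩ := (h1.and (h2.and self_mem_nhdsWithin)).exists
    exact ⟨ε, hε.2.2, hε.1, hε.2.1⟩
  set μ : ℝ := (u x₀ t₀ - P k₀ x₀) / 2 * (b - t₀) with hμdef
  have hμ : 0 < μ := mul_pos (by linarith) hbt
  set Φ : ι → Space n × ℝ → ℝ :=
    fun k q => u q.1 q.2 - (P k q.1 + ε * ‖X k‖ + μ / (b - q.2)) with hΦ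
  have hΦ0 : 0 < Φ k₀ (x₀, t₀) := by
    have : μ / (b - t₀) = (u x₀ t₀ - P k₀ x₀) / 2 := by rw [hμdef]; field_simp
    simp only [hΦ, this]
    linarith
  -- where a difference is positive, both penalties are less than `δ`
  have hpen : ∀ k ∈ G, ∀ x, ∀ t ∈ Ico a b, ‖x - X k‖ < 3 * ρ → 0 < Φ k (x, t) →
      ε * ‖X k‖ < δ ∧ μ / (b - t) < δ := by
    intro k hk x t ht hx hpos
    have h1 := hbound x t ht
    have h2 := h.envelope_le hk hx
    have h3 : 0 < μ / (b - t) := div_pos hμ (by linarith [ht.2])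
    have h4 : 0 ≤ ε * ‖X k‖ := by positivity
    simp only [hΦ] at hpos
    constructor <;> linarith
  set I : Set ι := {k | k ∈ G ∧ ε * ‖X k‖ ≤ δ + ε * (5 * ρ)} with hI
  have hIfin : I.Finite := by
    refine (h.locallyFinite (δ / ε + 5 * ρ)).subset fun k hk => ⟨hk.1, ?_⟩
    have := hk.2
    rw [← mul_le_mul_iff_right₀ hε, mul_add, mul_div_cancel₀ _ hε.ne']
    exact this
  set K : ι → Set (Space n × ℝ) :=
    fun k => Metric.closedBall (X k) (5 / 2 * ρ) ×ˢ Icc a (b - μ / δ) with hK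
  have hμδ : 0 < μ / δ := div_pos hμ hδ
  have hKc : ∀ k, IsCompact (K k) := fun k => (isCompact_closedBall _ _).prod isCompact_Icc
  have hKmem : ∀ k x t, (x, t) ∈ K k ↔ ‖x - X k‖ ≤ 5 / 2 * ρ ∧ a ≤ t ∧ t ≤ b - μ / δ := by
    intro k x t
    simp [hK, dist_eq_norm]
  have htime : ∀ t ∈ Ico a b, μ / (b - t) < δ → t < b - μ / δ := by
    intro t ht hlt
    have hbt : 0 < b - t := by linarith [ht.2]
    rw [div_lt_iff₀ hbt] at hlt
    have : μ / δ < b - t := by rwa [div_lt_iff₀' hδ]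
    linarith
  have hΦc : ∀ k, ContinuousOn (Φ k) (K k) := by
    intro k
    have h1 : ContinuousOn (fun q : Space n × ℝ => u q.1 q.2) (K k) :=
      hu.continuousOn.mono fun q hq =>
        ⟨mem_univ _, ha.trans hq.2.1, lt_of_lt_of_le (by linarith [hq.2.2]) hb⟩
    have h2 : Continuous (P k) :=
      continuous_iff_continuousAt.2 fun x => (h.contDiff k x).continuousAt
    have h3 : ContinuousOn (fun q : Space n × ℝ => μ / (b - q.2)) (K k) :=
      continuousOn_const.div (by fun_prop) fun q hq => by
        have := hq.2.2
        linarith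
    exact h1.sub ((((h2.comp continuous_fst).continuousOn).add continuousOn_const).add h3)
  have hk₀I : k₀ ∈ I := by
    have h1 := (hpen k₀ hk₀ x₀ t₀ ht₀ (by linarith) hΦ0).1
    exact ⟨hk₀, by nlinarith⟩
  have hmem0 : (x₀, t₀) ∈ K k₀ := by
    rw [hKmem]
    exact ⟨by linarith, ht₀.1, (htime t₀ ht₀ (hpen k₀ hk₀ x₀ t₀ ht₀ (by linarith) hΦ0).2).le⟩
  have hne : ∀ k, (K k).Nonempty := by
    intro k
    refine ⟨(X k, a), ?_⟩
    rw [hKmem] at hmem0 ⊢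
    refine ⟨by simp; linarith, le_rfl, by linarith [hmem0.2.1, hmem0.2.2]⟩
  choose q hqK hqmax using fun k => (hKc k).exists_isMaxOn (hne k) (hΦc k)
  obtain ⟨k, ⟨hkG, hkI⟩, hkmax⟩ := Set.exists_max_image I (fun k => Φ k (q k)) hIfin ⟨k₀, hk₀I⟩
  have hmax : ∀ k' ∈ I, ∀ p ∈ K k', Φ k' p ≤ Φ k (q k) := fun k' hk' p hp =>
    le_trans (hqmax k' hp) (hkmax k' hk')
  obtain ⟨x, t, hqk⟩ : ∃ x t, q k = (x, t) := ⟨_, _, rfl⟩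
  have hxt : (x, t) ∈ K k := hqk ▸ hqK k
  rw [hqk] at hmax
  obtain ⟨hx52, hat, htb⟩ := (hKmem k x t).1 hxt
  have hxk : ‖x - X k‖ < 3 * ρ := by linarith
  have htab : t ∈ Ico a b := ⟨hat, by linarith⟩
  have hpos : 0 < Φ k (x, t) := hΦ0.trans_le (hmax k₀ hk₀I _ hmem0)
  obtain ⟨hpk, hpt⟩ := hpen k hkG x t htab hxk hpos
  have htb' := htime t htab hpt
  have hx2 : ‖x - X k‖ < 2 * ρ := by
    by_contra! hfar
    obtain ⟨k', hk', hxk', hgap⟩ := h.gap k hkG x hfar hxk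
    have hXX : ‖X k'‖ ≤ ‖X k‖ + 5 * ρ := by
      have h1 : ‖X k' - X k‖ ≤ ‖X k' - x‖ + ‖x - X k‖ := norm_sub_le_norm_sub_add_norm_sub _ _ _
      have h2 : ‖X k'‖ ≤ ‖X k‖ + ‖X k' - X k‖ := by simpa using norm_add_le (X k) (X k' - X k)
      rw [norm_sub_rev (X k') x] at h1
      linarith
    have hεXX : ε * ‖X k'‖ ≤ ε * ‖X k‖ + ε * (5 * ρ) := by
      rw [← mul_add]; exact mul_le_mul_of_nonneg_left hXX hε.le
    have := hmax k' ⟨hk', by linarith⟩ (x, t) ((hKmem k' x t).2 ⟨by linarith, hat, htb⟩)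
    simp only [hΦ] at this
    linarith
  have hta : a < t := by
    refine lt_of_le_of_ne hat fun hat => ?_
    subst hat
    have h1 := (hinit x).trans (h.envelope_le hkG hxk)
    have h2 : 0 < μ / (b - a) := div_pos hμ (by linarith [htab.2])
    have h3 : 0 ≤ ε * ‖X k‖ := by positivity
    simp only [hΦ] at hpos
    linarith
  have hnear : ∀ᶠ p in 𝓝 (x, t), p ∈ K k := by
    have h1 : ∀ᶠ p : Space n × ℝ in 𝓝 (x, t), a < p.2 :=
      (continuous_snd.tendsto (x, t)).eventually (lt_mem_nhds hta)
    have h2 : ∀ᶠ p : Space n × ℝ in 𝓝 (x, t), p.2 < b - μ / δ :=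
      (continuous_snd.tendsto (x, t)).eventually (gt_mem_nhds htb')
    have h3 : ∀ᶠ p : Space n × ℝ in 𝓝 (x, t), ‖p.1 - X k‖ < 5 / 2 * ρ := by
      have hc : Continuous fun p : Space n × ℝ => ‖p.1 - X k‖ := by fun_prop
      exact (hc.tendsto (x, t)).eventually (gt_mem_nhds (by linarith))
    filter_upwards [h1, h2, h3] with p h1 h2 h3
    exact (hKmem k p.1 p.2).2 ⟨h3.le, h1.le, h2.le⟩
  set ψ : Space n × ℝ → ℝ := fun p => P k p.1 + (ε * ‖X k‖ + μ / (b - p.2)) with hψ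
  have hloc : IsLocalMax (fun p : Space n × ℝ => u p.1 p.2 - ψ p) (x, t) := by
    filter_upwards [hnear] with p hp
    have := hmax k ⟨hkG, hkI⟩ p hp
    simp only [hΦ, hψ] at this ⊢
    linarith
  have hbt' : 0 < b - t := by linarith [htab.2]
  have hψd : ContDiffAt ℝ 2 ψ (x, t) := by
    have h1 : ContDiffAt ℝ 2 (fun p : Space n × ℝ => P k p.1) (x, t) :=
      ContDiffAt.comp (x, t) (h.contDiff k x) contDiffAt_fst
    exact h1.add (contDiffAt_const.add
      (contDiffAt_const.div (contDiffAt_const.sub contDiffAt_snd) hbt'.ne'))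
  have hsub := hu.subsolution ψ x t ⟨ha.trans_lt hta, htab.2.trans_le hb⟩ hψd hloc
  have hder : deriv (fun s => ψ (x, s)) t = μ / (b - t) ^ 2 := by
    have h1 : HasDerivAt (fun s => b - s) (-1) t := (hasDerivAt_id t).const_sub b
    have h2 : HasDerivAt (fun s => μ / (b - s)) (μ / (b - t) ^ 2) t :=
      ((hasDerivAt_const t μ).fun_div h1 hbt'.ne').congr_deriv (by simp)
    have h3 : HasDerivAt (fun s => P k x + (ε * ‖X k‖ + μ / (b - s))) (μ / (b - t) ^ 2) t :=
      (h2.const_add _).const_add _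
    exact h3.deriv
  have hcurv : meanCurvature (fun z => ψ (z, t)) x = meanCurvature (P k) x :=
    meanCurvature_add_const (P k) (ε * ‖X k‖ + μ / (b - t)) x
  have hμt : 0 < μ / (b - t) := div_pos hμ hbt'
  have hek : 0 ≤ ε * ‖X k‖ := by positivity
  have hy1 : P k x ≤ u x t := by
    simp only [hΦ] at hpos
    linarith
  have hy2 : u x t ≤ P k x + δ := by
    have h1 := hbound x t htab
    have h2 := h.envelope_le hkG hxk
    linarith
  have hstrict := h.supersolution k hkG x hxk _ hy1 hy2
  rw [hder, hcurv] at hsub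
  have hpos2 : 0 < μ / (b - t) ^ 2 := by positivity
  have := areaElement_pos (fun z => ψ (z, t)) x
  nlinarith

/-- The flow that starts flat stays below the envelope. -/
theorem le_envelope (hn : 1 ≤ n) (h : IsBarrierFamily G X P f F δ ρ η) {F' T : ℝ}
    {u : Space n → ℝ → ℝ} (hu : IsForcedMCF f F' T u) (hF : F' ≤ F) (x : Space n) (t : ℝ)
    (ht : t ∈ Ico 0 T) : u x t ≤ envelope G X P (3 * ρ) x := by
  have hρ := h.radius_pos
  have hδ := h.raise_pos
  have hFp := h.force_pos
  have hTt : 0 < T - t := by linarith [ht.2]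
  -- the rate of the logarithmic barriers, so large that their lifetime is less than `T - t`
  set M : ℝ := 3 + 2 * ρ * F + (1 + F) * ρ ^ 2 + 2 * ρ ^ 2 / (T - t) with hMdef
  have hM : 2 + 2 * ρ * F + (1 + F) * ρ ^ 2 < M := by
    have : 0 < 2 * ρ ^ 2 / (T - t) := by positivity
    linarith
  have hM0 : 0 < M := lt_trans (by positivity) hM
  have hlife : ρ ^ 2 / M < T - t := by
    rw [div_lt_iff₀ hM0]
    have h1 : (T - t) * (2 * ρ ^ 2 / (T - t)) = 2 * ρ ^ 2 := by field_simp
    have h2 : 0 < (T - t) * (3 + 2 * ρ * F + (1 + F) * ρ ^ 2) := by positivity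
    have h3 : 0 < ρ ^ 2 := by positivity
    rw [hMdef, mul_add, h1]
    linarith
  -- the time for which the logarithmic barriers rise by at most `δ / 2` at their centres
  set τ : ℝ := ρ ^ 2 * (1 - Real.exp (-(δ / 2))) / M with hτ
  have hexp : Real.exp (-(δ / 2)) < 1 := by
    simpa using Real.exp_lt_exp.2 (show -(δ / 2) < 0 by linarith)
  have hτ0 : 0 < τ := div_pos (mul_pos (by positivity) (by linarith)) hM0
  have hMτ : M * τ = ρ ^ 2 * (1 - Real.exp (-(δ / 2))) := by rw [hτ]; field_simp
  have hstep : ∀ a, 0 ≤ a → a ≤ t → (∀ x, u x a ≤ envelope G X P (3 * ρ) x) →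
      ∀ x, ∀ s ∈ Ico a (a + τ), u x s ≤ envelope G X P (3 * ρ) x := by
    intro a ha0 hat hinit
    have hτT : τ ≤ ρ ^ 2 / M := by
      rw [hτ]
      refine div_le_div_of_nonneg_right ?_ hM0.le
      nlinarith [sq_nonneg ρ, Real.exp_pos (-(δ / 2))]
    refine h.le_envelope_of_le_add hu hF ha0 (by linarith) hinit fun x s hs => ?_
    have hms : M * (s - a) ≤ M * τ := mul_le_mul_of_nonneg_left (by linarith [hs.2]) hM0.le
    have hlow : ρ ^ 2 * Real.exp (-(δ / 2)) ≤ ρ ^ 2 - M * (s - a) := by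
      rw [hMτ] at hms
      linarith
    have hlowpos : 0 < ρ ^ 2 * Real.exp (-(δ / 2)) := by positivity
    have h1 := hu.le_logBarrier hn h.force_nonpos hF hFp hρ hM ha0 (by linarith)
      (x₀ := x) (c₀ := envelope G X P (3 * ρ) x + δ / 2)
      (fun z hz => (hinit z).trans (h.envelope_osc hz)) hs.1 (by linarith)
    have h2 := Real.log_le_log hlowpos hlow
    rw [Real.log_mul (by positivity) (Real.exp_pos _).ne', Real.log_exp] at h2
    linarith
  have hind : ∀ j : ℕ, ∀ x, ∀ s, 0 ≤ s → s ≤ t → s ≤ j * (τ / 2) →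
      u x s ≤ envelope G X P (3 * ρ) x := by
    intro j
    induction j with
    | zero =>
      intro x s hs0 _ hsj
      have : s = 0 := le_antisymm (by simpa using hsj) hs0
      rw [this, hu.initial]
      exact envelope_nonneg G X P _ x
    | succ j ih =>
      intro x s hs0 hst hsj
      rcases le_or_gt s (j * (τ / 2)) with hle | hgt
      · exact ih x s hs0 hst hle
      · have hj0 : 0 ≤ (j : ℝ) * (τ / 2) := by positivity
        push_cast at hsj
        exact hstep (j * (τ / 2)) hj0 (by linarith)
          (fun z => ih z _ hj0 (by linarith) le_rfl) x s ⟨hgt.le, by linarith⟩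
  obtain ⟨j, hj⟩ := exists_nat_ge (t / (τ / 2))
  exact hind j x t ht.1 le_rfl (by rwa [div_le_iff₀ (by positivity)] at hj)

end IsBarrierFamily

/-! ### The radial profile of a barrier -/

theorem curvature_core_bound {n p g₁ g₂ s c : ℝ} (hn : 1 ≤ n) (hg₁ : 0 ≤ g₁) (hg₂ : g₂ ≤ 0)
    (hs : 0 ≤ s) (hp : 1 ≤ p) (hc : 2 * g₁ ≤ c) :
    (2 * (n - 1) * g₁ + (2 * g₁ + 4 * g₂ * s) / (1 + 4 * g₁ ^ 2 * s)) / (n * p) ≤ c := by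
  have hD : 1 ≤ 1 + 4 * g₁ ^ 2 * s := by
    have : 0 ≤ 4 * g₁ ^ 2 * s := by positivity
    linarith
  have h1 : (2 * g₁ + 4 * g₂ * s) / (1 + 4 * g₁ ^ 2 * s) ≤ 2 * g₁ := by
    rw [div_le_iff₀ (by linarith)]
    nlinarith [mul_nonneg (neg_nonneg.2 hg₂) hs]
  rw [div_le_iff₀ (by positivity)]
  have h2 : c * n ≤ c * (n * p) := by 
    nlinarith [mul_nonneg (by linarith : 0 ≤ c) (by linarith : 0 ≤ n)]
  nlinarith

theorem curvature_outer_bound {n p g₁ g₂ s : ℝ} (hn : 1 ≤ n) (hg₁ : 0 ≤ g₁)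
    (hg₂ : 2 * g₁ + 4 * g₂ * s ≤ -(2 * n * g₁)) (hs : 0 ≤ s) (hp : 0 < p) (hp2 : p ≤ 2)
    (hq : n * (4 * g₁ ^ 2 * s) ≤ 1 / 2) :
    (2 * (n - 1) * g₁ + (2 * g₁ + 4 * g₂ * s) / (1 + 4 * g₁ ^ 2 * s)) / (n * p)
      ≤ -(g₁ / (4 * n)) := by
  have hq0 : 0 ≤ 4 * g₁ ^ 2 * s := by positivity
  generalize 4 * g₁ ^ 2 * s = q at *
  have h1 : (2 * g₁ + 4 * g₂ * s) / (1 + q) ≤ -(2 * n * g₁) / (1 + q) :=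
    div_le_div_of_nonneg_right hg₂ (by linarith)
  have h2 : 2 * (n - 1) * g₁ + -(2 * n * g₁) / (1 + q) ≤ -(g₁ / 2) := by
    have : -(2 * n * g₁) / (1 + q) ≤ -(g₁ / 2) - 2 * (n - 1) * g₁ := by
      rw [div_le_iff₀ (by linarith)]
      nlinarith [mul_nonneg hg₁ hq0, mul_le_mul_of_nonneg_left hq hg₁]
    linarith
  have h3 : -(g₁ / 2) / (n * p) ≤ -(g₁ / (4 * n)) := by
    rw [div_le_iff₀ (by positivity)]
    have : g₁ / (4 * n) * (n * p) = g₁ * p / 4 := by field_simp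
    rw [neg_mul, this]
    nlinarith
  refine le_trans (div_le_div_of_nonneg_right ?_ (by positivity)) h3
  linarith

set_option maxHeartbeats 400000 in
/-- Existence of the radial profile of the barriers, a function of the squared distance to the
centre. It is `A (r⁻²ᵃ - (s + r²)⁻ᵃ)` with `a = n / 2 - 1 / 4`. Since `2 a > n - 2`, it is strictly
superharmonic away from the centre, which survives for the mean curvature if `A` is small; since `2
a < n`, the increment of the profile between the distances `n d` and `2 n d`, multiplied by `dⁿ`,
can be made arbitrarily large. Near the centre the profile is convex; the bound by `c` matters only
there. -/
theorem exists_profile (n : ℕ) (hn : 1 ≤ n) {r₀ c K : ℝ} (hr : 0 < r₀) (hc : 0 < c) :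
    ∃ (g : ℝ → ℝ) (d F₁ : ℝ), 0 < d ∧ 0 < F₁ ∧ (∀ s, 0 ≤ s → ContDiffAt ℝ 2 g s) ∧
      (∀ s, 0 ≤ s → 0 ≤ g s ∧ g s ≤ r₀ / 4) ∧ MonotoneOn g (Ici 0) ∧
      g ((n * d) ^ 2) < g ((2 * (n * d)) ^ 2) ∧
      K ≤ d ^ n * (g ((2 * (n * d)) ^ 2) - g ((n * d) ^ 2)) ∧
      (∀ X x : Space n, meanCurvature (fun z => g (‖z - X‖ ^ 2)) x ≤ c) ∧
      (∀ X x : Space n, r₀ ≤ ‖x - X‖ → ‖x - X‖ ≤ 3 * (n * d) →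
        meanCurvature (fun z => g (‖z - X‖ ^ 2)) x ≤ -F₁) := by
  have hn' : (1 : ℝ) ≤ n := by exact_mod_cast hn
  set a : ℝ := n / 2 - 1 / 4 with ha
  have ha0 : 0 < a := by linarith
  set β : ℝ := r₀ ^ 2 / (2 * (n + 1)) with hβ
  have hβ0 : 0 < β := by positivity
  have hβr : 2 * (n + 1) * β = r₀ ^ 2 := by rw [hβ]; field_simp
  obtain ⟨A, hA, hA1, hAg, hAc, hAq⟩ : ∃ A : ℝ, 0 < A ∧ A ≤ 1 ∧ A * β ^ (-a) ≤ r₀ / 4 ∧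
      A * (2 * a * β ^ (-a - 1)) ≤ c ∧
      A * (n * (4 * (a ^ 2 * (β ^ (-a) * β ^ (-a - 1))))) ≤ 1 / 2 := by
    have small : ∀ C b : ℝ, 0 < b → ∀ᶠ A in 𝓝[>] (0 : ℝ), A * C ≤ b := by
      intro C b hb
      have hcont : Continuous fun A : ℝ => A * C := by fun_prop
      exact nhdsWithin_le_nhds ((hcont.tendsto 0).eventually (ge_mem_nhds (by simpa using hb)))
    obtain ⟨A, h⟩ := ((small 1 1 one_pos).and ((small (β ^ (-a)) (r₀ / 4) (by linarith)).and
      ((small (2 * a * β ^ (-a - 1)) c hc).and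
        ((small (n * (4 * (a ^ 2 * (β ^ (-a) * β ^ (-a - 1))))) (1 / 2) (by norm_num)).and
          self_mem_nhdsWithin)))).exists
    exact ⟨A, h.2.2.2.2, by simpa using h.1, h.2.1, h.2.2.1, h.2.2.2.1⟩
  set g : ℝ → ℝ := fun s => A * (β ^ (-a) - (s + β) ^ (-a)) with hg
  set g₁ : ℝ → ℝ := fun s => A * (a * (s + β) ^ (-a - 1)) with hg₁
  have hanti : ∀ e : ℝ, 0 ≤ e → ∀ s t : ℝ, 0 < s → s ≤ t → t ^ (-e) ≤ s ^ (-e) :=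
    fun e he s t hs hst => Real.rpow_le_rpow_of_nonpos hs hst (by linarith)
  have hd1 : ∀ s, 0 < s + β → HasDerivAt g (g₁ s) s := by
    intro s hs
    have h := (((hasDerivAt_id s).add_const β).rpow_const (p := -a) (Or.inl hs.ne')).const_sub
      (β ^ (-a))
    exact (h.const_mul A).congr_deriv (by simp [hg₁])
  have hd2 : ∀ s, 0 < s + β →
      HasDerivAt g₁ (-((a + 1) * g₁ s / (s + β))) s := by
    intro s hs
    have h := ((hasDerivAt_id s).add_const β).rpow_const (p := -a - 1) (Or.inl hs.ne')
    refine ((h.const_mul a).const_mul A).congr_deriv ?_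
    simp only [hg₁, id]
    rw [Real.rpow_sub_one hs.ne' (-a - 1)]
    field_simp
    ring
  have hg₁0 : ∀ s, 0 ≤ s → 0 < g₁ s := by
    intro s hs
    have : 0 < s + β := by linarith
    simp only [hg₁]
    positivity
  have hcurv : ∀ X x : Space n,
      meanCurvature (fun z => g (‖z - X‖ ^ 2)) x = (2 * (n - 1) * g₁ (‖x - X‖ ^ 2) +
      (2 * g₁ (‖x - X‖ ^ 2)
        + 4 * -((a + 1) * g₁ (‖x - X‖ ^ 2) / (‖x - X‖ ^ 2 + β)) * ‖x - X‖ ^ 2)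
        / (1 + 4 * g₁ (‖x - X‖ ^ 2) ^ 2 * ‖x - X‖ ^ 2))
      / (n * Real.sqrt (1 + 4 * g₁ (‖x - X‖ ^ 2) ^ 2 * ‖x - X‖ ^ 2)) := by
    intro X x
    have hpos : 0 < ‖x - X‖ ^ 2 + β := by positivity
    refine (meanCurvature_radial ?_ (hd2 _ hpos)).2
    have hcont : Continuous fun t : ℝ => t + β := by fun_prop
    filter_upwards [(hcont.tendsto (‖x - X‖ ^ 2)).eventually (lt_mem_nhds hpos)] with t ht
    exact hd1 t ht
  have hg₁le : ∀ s, 0 ≤ s → g₁ s ≤ A * (a * β ^ (-a - 1)) := by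
    intro s hs
    have := hanti (a + 1) (by linarith) β (s + β) hβ0 (by linarith)
    rw [neg_add'] at this
    simp only [hg₁]
    gcongr
  have hq : ∀ s, 0 ≤ s → n * (4 * g₁ s ^ 2 * s) ≤ 1 / 2 := by
    intro s hs
    have hsβ : 0 < s + β := by linarith
    have h1 : g₁ s * s ≤ A * (a * β ^ (-a)) := by
      calc g₁ s * s ≤ g₁ s * (s + β) := by
            have := (hg₁0 s hs).le
            gcongr
            linarith
        _ = A * (a * (s + β) ^ (-a)) := by
            simp only [hg₁]
            rw [Real.rpow_sub_one hsβ.ne']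
            field_simp
        _ ≤ A * (a * β ^ (-a)) := by
            have := hanti a ha0.le β (s + β) hβ0 (by linarith)
            gcongr
    have h2 : g₁ s ^ 2 * s ≤ A * (a * β ^ (-a)) * (A * (a * β ^ (-a - 1))) := by
      have := mul_le_mul h1 (hg₁le s hs) (hg₁0 s hs).le (by positivity)
      linarith
    have h3 : A * (a * β ^ (-a)) * (A * (a * β ^ (-a - 1)))
        ≤ A * (a ^ 2 * (β ^ (-a) * β ^ (-a - 1))) := by
      have h0 : 0 ≤ A * (a ^ 2 * (β ^ (-a) * β ^ (-a - 1))) := by positivity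
      have := mul_le_mul_of_nonneg_right hA1 h0
      linarith
    have h4 : (n : ℝ) * (4 * (g₁ s ^ 2 * s))
        ≤ n * (4 * (A * (a ^ 2 * (β ^ (-a) * β ^ (-a - 1))))) := by
      have := h2.trans h3
      gcongr
    linarith
  have hmono : MonotoneOn g (Ici 0) := by
    intro s hs t ht hst
    have hs0 : (0 : ℝ) ≤ s := hs
    have := hanti a ha0.le (s + β) (t + β) (by linarith) (by linarith)
    simp only [hg]
    gcongr
  -- the increment of the profile between the distances `n d` and `2 n d`
  set κ : ℝ := A * ((n : ℝ) ^ (-(2 * a)) * (2 ^ (-a) - 4 ^ (-a))) with hκ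
  have h24 : (4 : ℝ) ^ (-a) < 2 ^ (-a) :=
    Real.rpow_lt_rpow_of_neg (by norm_num) (by norm_num) (by linarith)
  have hκ0 : 0 < κ := by
    have : 0 < (2 : ℝ) ^ (-a) - 4 ^ (-a) := by linarith
    have : 0 < (n : ℝ) ^ (-(2 * a)) := Real.rpow_pos_of_pos (by linarith) _
    positivity
  have hinc : ∀ d : ℝ, 0 < d → β ≤ (n * d) ^ 2 →
      κ * d ^ (-(2 * a)) ≤ g ((2 * (n * d)) ^ 2) - g ((n * d) ^ 2) := by
    intro d hd hβd
    have hnd : 0 < n * d := by positivity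
    have h1 := hanti a ha0.le ((n * d) ^ 2 + β) (2 * (n * d) ^ 2) (by positivity) (by linarith)
    have h2 := hanti a ha0.le (4 * (n * d) ^ 2) ((2 * (n * d)) ^ 2 + β) (by positivity)
      (by nlinarith)
    have h3 : ((n * d) ^ 2) ^ (-a) = (n : ℝ) ^ (-(2 * a)) * d ^ (-(2 * a)) := by
      rw [← Real.mul_rpow (by positivity) hd.le, ← Real.rpow_natCast, ← Real.rpow_mul hnd.le]
      congr 1
      push_cast
      ring
    rw [Real.mul_rpow (by norm_num) (by positivity), h3] at h1 h2
    have h4 : g ((2 * (n * d)) ^ 2) - g ((n * d) ^ 2)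
        = A * (((n * d) ^ 2 + β) ^ (-a) - ((2 * (n * d)) ^ 2 + β) ^ (-a)) := by
      simp only [hg]
      ring
    rw [h4]
    calc κ * d ^ (-(2 * a)) = A * (2 ^ (-a) * ((n : ℝ) ^ (-(2 * a)) * d ^ (-(2 * a)))
          - 4 ^ (-a) * ((n : ℝ) ^ (-(2 * a)) * d ^ (-(2 * a)))) := by rw [hκ]; ring
      _ ≤ _ := by gcongr
  obtain ⟨d, hd1', hdβ, hdK⟩ : ∃ d : ℝ, 1 ≤ d ∧ β ≤ d ∧ K ≤ κ * d ^ (1 / 2 : ℝ) := by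
    have h1 : Tendsto (fun d : ℝ => κ * d ^ (1 / 2 : ℝ)) atTop atTop :=
      (tendsto_rpow_atTop (by norm_num)).const_mul_atTop hκ0
    obtain ⟨d, h⟩ := ((eventually_ge_atTop (1 : ℝ)).and ((eventually_ge_atTop β).and
      (h1.eventually_ge_atTop K))).exists
    exact ⟨d, h.1, h.2.1, h.2.2⟩
  have hd0 : 0 < d := by linarith
  have hβd : β ≤ (n * d) ^ 2 := by
    have : d ≤ n * d := by nlinarith
    nlinarith
  have hincd := hinc d hd0 hβd
  refine ⟨g, d, g₁ ((3 * (n * d)) ^ 2) / (4 * n), hd0, ?_, ?_, ?_, hmono, ?_, ?_, ?_, ?_⟩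
  · have := hg₁0 ((3 * (n * d)) ^ 2) (by positivity)
    positivity
  · intro s hs
    have hpos : s + β ≠ 0 := by linarith
    exact contDiffAt_const.mul (contDiffAt_const.sub
      ((contDiffAt_id.add contDiffAt_const).rpow_const_of_ne hpos))
  · intro s hs
    have h1 := hanti a ha0.le β (s + β) hβ0 (by linarith)
    have h2 : 0 ≤ (s + β) ^ (-a) := Real.rpow_nonneg (by linarith) _
    have h3 : A * (β ^ (-a) - (s + β) ^ (-a)) ≤ A * β ^ (-a) := by
      gcongr
      linarith
    exact ⟨mul_nonneg hA.le (by linarith), h3.trans hAg⟩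
  · have : 0 < κ * d ^ (-(2 * a)) := by positivity
    linarith
  · have h1 : d ^ n * (κ * d ^ (-(2 * a))) = κ * d ^ (1 / 2 : ℝ) := by
      rw [mul_left_comm, ← Real.rpow_natCast, ← Real.rpow_add hd0]
      congr 2
      rw [ha]
      ring
    calc K ≤ d ^ n * (κ * d ^ (-(2 * a))) := by rw [h1]; exact hdK
      _ ≤ _ := by gcongr
  · intro X x
    rw [hcurv]
    have hpos : 0 < ‖x - X‖ ^ 2 + β := by positivity
    have h1 := hg₁0 (‖x - X‖ ^ 2) (by positivity)
    refine curvature_core_bound hn' h1.le ?_ (by positivity) ?_ ?_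
    · have : 0 ≤ (a + 1) * g₁ (‖x - X‖ ^ 2) / (‖x - X‖ ^ 2 + β) := by positivity
      linarith
    · rw [Real.one_le_sqrt]
      have : 0 ≤ 4 * g₁ (‖x - X‖ ^ 2) ^ 2 * ‖x - X‖ ^ 2 := by positivity
      linarith
    · have := hg₁le (‖x - X‖ ^ 2) (by positivity)
      linarith
  · intro X x hx1 hx2
    rw [hcurv]
    have hs : r₀ ^ 2 ≤ ‖x - X‖ ^ 2 := by gcongr
    have hs2 : ‖x - X‖ ^ 2 ≤ (3 * (n * d)) ^ 2 := by gcongr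
    have hs0 : 0 ≤ ‖x - X‖ ^ 2 := by positivity
    generalize ‖x - X‖ ^ 2 = s at *
    have hsβ : 0 < s + β := by linarith
    have h1 := hg₁0 s hs0
    have hq' := hq s hs0
    have hq0 : 0 ≤ 4 * g₁ s ^ 2 * s := by positivity
    refine (curvature_outer_bound hn' h1.le ?_ hs0 (Real.sqrt_pos.2 (by linarith)) ?_ hq').trans ?_
    · have h2 : g₁ s * (2 * n + 2) ≤ 4 * ((a + 1) * g₁ s / (s + β)) * s := by
        have : 4 * ((a + 1) * g₁ s / (s + β)) * s = g₁ s * ((2 * n + 3) * s / (s + β)) := by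
          rw [ha]; field_simp; ring
        rw [this]
        gcongr
        rw [le_div_iff₀ hsβ]
        linarith
      linarith
    · rw [Real.sqrt_le_left (by norm_num)]
      have := mul_le_mul_of_nonneg_right hn' hq0
      linarith
    · have h2 : g₁ ((3 * (n * d)) ^ 2) ≤ g₁ s := by
        have := hanti (a + 1) (by linarith) (s + β) ((3 * (n * d)) ^ 2 + β) hsβ (by linarith)
        rw [neg_add'] at this
        simp only [hg₁]
        gcongr
      have : g₁ ((3 * (n * d)) ^ 2) / (4 * n) ≤ g₁ s / (4 * n) := by gcongr
      linarith

/-! ### Lipschitz percolation -/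

/-- `Reach N C m σ`: the site `σ = (z, h)` can be reached in `m` steps from a site of height at
most `0`. A step leads either upwards into a site of `C` (the closed sites), or downwards by one
with an arbitrary displacement of at most `N` in each coordinate. -/
def Reach {n : ℕ} (N : ℕ) (C : (Fin n → ℤ) × ℤ → Prop) : ℕ → (Fin n → ℤ) × ℤ → Prop
  | 0, σ => σ.2 ≤ 0
  | m + 1, σ => (C σ ∧ Reach N C m (σ.1, σ.2 - 1)) ∨
      ∃ e ∈ Finset.Icc (fun _ : Fin n => -(N : ℤ)) (fun _ => (N : ℤ)),
        Reach N C m (σ.1 + e, σ.2 + 1)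

/-- `FirstReach N C m σ`: the site `σ` can be reached in `m` steps, but not in fewer. -/
def FirstReach {n : ℕ} (N : ℕ) (C : (Fin n → ℤ) × ℤ → Prop) (m : ℕ) (σ : (Fin n → ℤ) × ℤ) : Prop :=
  Reach N C m σ ∧ ∀ m' < m, ¬ Reach N C m' σ

theorem FirstReach.unique {n N : ℕ} {C : (Fin n → ℤ) × ℤ → Prop} {m m' : ℕ}
    {σ : (Fin n → ℤ) × ℤ} (h : FirstReach N C m σ) (h' : FirstReach N C m' σ) : m = m' := by
  rcases lt_trichotomy m m' with hlt | heq | hlt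
  · exact absurd h.1 (h'.2 m hlt)
  · exact heq
  · exact absurd h'.1 (h.2 m' hlt)

theorem FirstReach.one_le_height {n N : ℕ} {C : (Fin n → ℤ) × ℤ → Prop} {m : ℕ}
    {σ : (Fin n → ℤ) × ℤ} (h : FirstReach N C (m + 1) σ) : 1 ≤ σ.2 := by
  by_contra! hlt
  exact h.2 0 (Nat.succ_pos m) (by simp only [Reach]; omega)

/-- The predecessor of a site on a shortest path. -/
theorem FirstReach.pred {n N : ℕ} {C : (Fin n → ℤ) × ℤ → Prop} {m : ℕ}
    {σ : (Fin n → ℤ) × ℤ} (h : FirstReach N C (m + 1) σ) :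
    (C σ ∧ FirstReach N C m (σ.1, σ.2 - 1)) ∨
      ∃ e ∈ Finset.Icc (fun _ : Fin n => -(N : ℤ)) (fun _ => (N : ℤ)),
        FirstReach N C m (σ.1 + e, σ.2 + 1) := by
  rcases h.1 with ⟨hC, hr⟩ | ⟨e, he, hr⟩
  · refine Or.inl ⟨hC, hr, fun m' hm' hr' => h.2 (m' + 1) (by omega) (Or.inl ⟨hC, hr'⟩)⟩
  · exact Or.inr ⟨e, he, hr, fun m' hm' hr' => h.2 (m' + 1) (by omega) (Or.inr ⟨e, he, hr'⟩)⟩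

/-- The closed sites on shortest paths of length `m` to a given site of height `h`: there are at
most `Mᵐ` possibilities for the set of these sites, where `M` is the number of steps, and each of
these sets has at least `(m + h) / 2` elements. The sites are distinct since their distances to
height `0` are. -/
theorem exists_closedSites {n : ℕ} (N : ℕ) (m : ℕ) (σ : (Fin n → ℤ) × ℤ) :
    ∃ 𝓕 : Finset (Finset ((Fin n → ℤ) × ℤ)),
      𝓕.card ≤ ((Finset.Icc (fun _ : Fin n => -(N : ℤ)) (fun _ => (N : ℤ))).card + 1) ^ m ∧
      (∀ S ∈ 𝓕, m + σ.2 ≤ 2 * S.card ∧ ∀ τ ∈ S, 1 ≤ τ.2) ∧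
      ∀ C : (Fin n → ℤ) × ℤ → Prop, FirstReach N C m σ →
        ∃ S ∈ 𝓕, ∀ τ ∈ S, C τ ∧ ∃ m' ≤ m, FirstReach N C m' τ := by
  classical
  induction m generalizing σ with
  | zero =>
    refine ⟨if σ.2 ≤ 0 then {∅} else ∅, ?_, ?_, ?_⟩
    · split_ifs <;> simp
    · intro S hS
      split_ifs at hS with h
      · rw [Finset.mem_singleton] at hS
        subst hS
        simpa using h
      · simp at hS
    · intro C hC
      have h : σ.2 ≤ 0 := hC.1
      exact ⟨∅, by simp [h], by simp⟩
  | succ m ih =>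
    choose 𝓕 hcard hsize hex using ih
    set B := Finset.Icc (fun _ : Fin n => -(N : ℤ)) (fun _ => (N : ℤ)) with hB
    refine ⟨(((𝓕 (σ.1, σ.2 - 1)).filter fun S => σ ∉ S ∧ 1 ≤ σ.2).image (insert σ)) ∪
      B.biUnion fun e => 𝓕 (σ.1 + e, σ.2 + 1), ?_, ?_, ?_⟩
    · refine (Finset.card_union_le _ _).trans ?_
      have h1 : (((𝓕 (σ.1, σ.2 - 1)).filter fun S => σ ∉ S ∧ 1 ≤ σ.2).image (insert σ)).card
          ≤ (B.card + 1) ^ m :=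
        Finset.card_image_le.trans ((Finset.card_filter_le _ _).trans (hcard _))
      have h2 : (B.biUnion fun e => 𝓕 (σ.1 + e, σ.2 + 1)).card ≤ B.card * (B.card + 1) ^ m :=
        Finset.card_biUnion_le_card_mul _ _ _ fun e _ => hcard _
      rw [pow_succ]
      linarith
    · intro S hS
      rw [Finset.mem_union] at hS
      rcases hS with hS | hS
      · obtain ⟨S', hS', rfl⟩ := Finset.mem_image.1 hS
        obtain ⟨hS', hσ, hpos⟩ := Finset.mem_filter.1 hS'
        obtain ⟨h1, h2⟩ := hsize _ S' hS'
        constructor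
        · rw [Finset.card_insert_of_notMem hσ]
          push_cast
          simp only at h1
          linarith
        · intro τ hτ
          rcases Finset.mem_insert.1 hτ with rfl | hτ
          · exact hpos
          · exact h2 τ hτ
      · obtain ⟨e, _, hS⟩ := Finset.mem_biUnion.1 hS
        obtain ⟨h1, h2⟩ := hsize _ S hS
        refine ⟨?_, h2⟩
        push_cast
        simp only at h1
        linarith
    · intro C hC
      rcases hC.pred with ⟨hCσ, hr⟩ | ⟨e, he, hr⟩
      · obtain ⟨S, hS, hS'⟩ := hex _ C hr
        have hσ : σ ∉ S := fun hσ => by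
          obtain ⟨m', hm', hr'⟩ := (hS' σ hσ).2
          have := hC.unique hr'
          omega
        refine ⟨insert σ S, Finset.mem_union_left _ (Finset.mem_image_of_mem _
          (Finset.mem_filter.2 ⟨hS, hσ, hC.one_le_height⟩)), fun τ hτ => ?_⟩
        rcases Finset.mem_insert.1 hτ with rfl | hτ
        · exact ⟨hCσ, m + 1, le_rfl, hC⟩
        · obtain ⟨h1, m', hm', h2⟩ := hS' τ hτ
          exact ⟨h1, m', by omega, h2⟩
      · obtain ⟨S, hS, hS'⟩ := hex _ C hr
        refine ⟨S, Finset.mem_union_right _ (Finset.mem_biUnion.2 ⟨e, he, hS⟩), fun τ hτ => ?_⟩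
        obtain ⟨h1, m', hm', h2⟩ := hS' τ hτ
        exact ⟨h1, m', by omega, h2⟩

theorem exists_firstReach {n N : ℕ} {C : (Fin n → ℤ) × ℤ → Prop} {m : ℕ}
    {σ : (Fin n → ℤ) × ℤ} (h : Reach N C m σ) : ∃ m', FirstReach N C m' σ := by
  classical
  have hex : ∃ m, Reach N C m σ := ⟨m, h⟩
  exact ⟨Nat.find hex, Nat.find_spec hex, fun m' hm' => Nat.find_min hex hm'⟩

theorem measurableSet_reach {n N : ℕ} {Ω : Type*} [MeasurableSpace Ω]
    {C : Ω → (Fin n → ℤ) × ℤ → Prop} (hC : ∀ σ, MeasurableSet {ω | C ω σ}) (m : ℕ)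
    (σ : (Fin n → ℤ) × ℤ) : MeasurableSet {ω | Reach N (C ω) m σ} := by
  induction m generalizing σ with
  | zero => exact MeasurableSet.const _
  | succ m ih =>
    have : {ω | Reach N (C ω) (m + 1) σ} = ({ω | C ω σ} ∩ {ω | Reach N (C ω) m (σ.1, σ.2 - 1)}) ∪
        ⋃ e ∈ Finset.Icc (fun _ : Fin n => -(N : ℤ)) (fun _ => (N : ℤ)),
          {ω | Reach N (C ω) m (σ.1 + e, σ.2 + 1)} := by
      ext ω
      simp only [Reach, mem_ofPred_eq, mem_union, mem_inter_iff, mem_iUnion, exists_prop]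
    rw [this]
    exact ((hC σ).inter (ih _)).union (Finset.measurableSet_biUnion _ fun e _ => ih _)

/-- If closed sites are sufficiently rare, then almost surely every column contains a site that
cannot be reached. The probability that a site of height `h` can be reached is estimated by the
sum over the lengths of shortest paths. -/
theorem ae_exists_not_reach {n N : ℕ} {Ω : Type*} [MeasurableSpace Ω] {P : Measure Ω}
    {C : Ω → (Fin n → ℤ) × ℤ → Prop} {θ : ℝ≥0∞}
    (hθ : θ * ((Finset.Icc (fun _ : Fin n => -(N : ℤ)) (fun _ => (N : ℤ))).card + 1) ≤ 1 / 2)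
    (hC : ∀ S : Finset ((Fin n → ℤ) × ℤ), (∀ τ ∈ S, 1 ≤ τ.2) →
      P {ω | ∀ τ ∈ S, C ω τ} ≤ θ ^ (2 * S.card)) :
    ∀ᵐ ω ∂P, ∀ z : Fin n → ℤ, ∃ h : ℕ, 1 ≤ h ∧ ∀ m, ¬ Reach N (C ω) m (z, (h : ℤ)) := by
  set M : ℕ := (Finset.Icc (fun _ : Fin n => -(N : ℤ)) (fun _ => (N : ℤ))).card + 1 with hM
  have hθ' : θ * (M : ℝ≥0∞) ≤ 1 / 2 := by rw [hM]; push_cast; exact hθ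
  have hM1 : (1 : ℝ≥0∞) ≤ M := by rw [hM]; push_cast; exact le_add_self
  have hθ2 : θ ≤ 1 / 2 := by
    calc θ = θ * 1 := (mul_one θ).symm
      _ ≤ θ * M := by gcongr
      _ ≤ 1 / 2 := hθ'
  have hθ1 : θ ≤ 1 := hθ2.trans (by simp)
  have hm : ∀ (m h : ℕ) (z : Fin n → ℤ),
      P {ω | FirstReach N (C ω) m (z, (h : ℤ))} ≤ θ ^ h * (1 / 2) ^ m := by
    intro m h z
    obtain ⟨𝓕, h1, h2, h3⟩ := exists_closedSites N m ((z, (h : ℤ)) : (Fin n → ℤ) × ℤ)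
    calc P {ω | FirstReach N (C ω) m (z, (h : ℤ))}
        ≤ P (⋃ S ∈ 𝓕, {ω | ∀ τ ∈ S, C ω τ}) := by
          refine measure_mono fun ω hω => ?_
          obtain ⟨S, hS, hS'⟩ := h3 _ hω
          exact mem_biUnion hS fun τ hτ => (hS' τ hτ).1
      _ ≤ ∑ S ∈ 𝓕, P {ω | ∀ τ ∈ S, C ω τ} := measure_biUnion_finset_le _ _
      _ ≤ ∑ S ∈ 𝓕, θ ^ (m + h) := by
          refine Finset.sum_le_sum fun S hS => (hC S (h2 S hS).2).trans ?_
          refine pow_le_pow_of_le_one zero_le hθ1 ?_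
          have := (h2 S hS).1
          simp only at this
          omega
      _ = 𝓕.card * θ ^ (m + h) := by simp
      _ ≤ (M : ℝ≥0∞) ^ m * θ ^ (m + h) := by
          gcongr
          exact_mod_cast h1
      _ = θ ^ h * (θ * M) ^ m := by rw [pow_add, mul_pow]; ring
      _ ≤ θ ^ h * (1 / 2) ^ m := by gcongr
  have hreach : ∀ (h : ℕ) (z : Fin n → ℤ),
      P {ω | ∃ m, Reach N (C ω) m (z, (h : ℤ))} ≤ θ ^ h * 2 := by
    intro h z
    calc P {ω | ∃ m, Reach N (C ω) m (z, (h : ℤ))}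
        ≤ P (⋃ m, {ω | FirstReach N (C ω) m (z, (h : ℤ))}) := by
          refine measure_mono fun ω ⟨m, hω⟩ => ?_
          obtain ⟨m', hm'⟩ := exists_firstReach hω
          exact mem_iUnion.2 ⟨m', hm'⟩
      _ ≤ ∑' m, P {ω | FirstReach N (C ω) m (z, (h : ℤ))} := measure_iUnion_le _
      _ ≤ ∑' m : ℕ, θ ^ h * (1 / 2) ^ m := ENNReal.tsum_le_tsum fun m => hm m h z
      _ = θ ^ h * 2 := by
          rw [ENNReal.tsum_mul_left, ENNReal.tsum_geometric]
          simp
  rw [ae_all_iff]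
  intro z
  have hlim : Tendsto (fun h : ℕ => θ ^ h * 2) atTop (𝓝 0) := by
    have hlt : θ < 1 := hθ2.trans_lt (by simp)
    have := ENNReal.Tendsto.mul_const (ENNReal.tendsto_pow_atTop_nhds_zero_of_lt_one hlt)
      (b := 2) (Or.inr (by simp))
    simpa using this
  rw [ae_iff]
  refine le_antisymm (ge_of_tendsto hlim ?_) zero_le
  filter_upwards [eventually_ge_atTop 1] with h hh
  refine (measure_mono fun ω hω => ?_).trans (hreach h z)
  simp only [mem_ofPred_eq, not_exists, not_and, not_forall, not_not] at hω
  exact hω h hh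

/-- `IsLevel N C z h`: `h` is the lowest height in the column of `z` that cannot be reached. -/
def IsLevel {n : ℕ} (N : ℕ) (C : (Fin n → ℤ) × ℤ → Prop) (z : Fin n → ℤ) (h : ℕ) : Prop :=
  1 ≤ h ∧ (∀ m, ¬ Reach N C m (z, (h : ℤ))) ∧
    ∀ j : ℕ, 1 ≤ j → j < h → ∃ m, Reach N C m (z, (j : ℤ))

theorem exists_isLevel {n N : ℕ} {C : (Fin n → ℤ) × ℤ → Prop} {z : Fin n → ℤ}
    (h : ∃ h : ℕ, 1 ≤ h ∧ ∀ m, ¬ Reach N C m (z, (h : ℤ))) : ∃ h, IsLevel N C z h := by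
  classical
  refine ⟨Nat.find h, (Nat.find_spec h).1, (Nat.find_spec h).2, fun j hj hlt => ?_⟩
  have := Nat.find_min h hlt
  push Not at this
  exact this hj

theorem IsLevel.unique {n N : ℕ} {C : (Fin n → ℤ) × ℤ → Prop} {z : Fin n → ℤ} {h h' : ℕ}
    (hl : IsLevel N C z h) (hl' : IsLevel N C z h') : h = h' := by
  rcases lt_trichotomy h h' with hlt | heq | hlt
  · obtain ⟨m, hm⟩ := hl'.2.2 h hl.1 hlt
    exact absurd hm (hl.2.1 m)
  · exact heq
  · obtain ⟨m, hm⟩ := hl.2.2 h' hl'.1 hlt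
    exact absurd hm (hl'.2.1 m)

/-- The site on the level surface is not closed. -/
theorem IsLevel.not_closed {n N : ℕ} {C : (Fin n → ℤ) × ℤ → Prop} {z : Fin n → ℤ} {h : ℕ}
    (hl : IsLevel N C z h) : ¬ C (z, (h : ℤ)) := by
  intro hC
  obtain ⟨h1, h2, h3⟩ := hl
  rcases Nat.lt_or_ge 1 h with hlt | hle
  · obtain ⟨m, hm⟩ := h3 (h - 1) (by omega) (by omega)
    refine h2 (m + 1) (Or.inl ⟨hC, ?_⟩)
    rwa [Nat.cast_sub h1, Nat.cast_one] at hm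
  · have : h = 1 := le_antisymm hle h1
    subst this
    exact h2 1 (Or.inl ⟨hC, by simp [Reach]⟩)

/-- The Lipschitz property of the level surface. -/
theorem IsLevel.le_add_one {n N : ℕ} {C : (Fin n → ℤ) × ℤ → Prop} {z z' : Fin n → ℤ} {h h' : ℕ}
    (hl : IsLevel N C z h) (hl' : IsLevel N C z' h') (hz : ∀ i, |z i - z' i| ≤ N) :
    h ≤ h' + 1 := by
  by_contra! hlt
  obtain ⟨m, hm⟩ := hl.2.2 (h' + 1) (by omega) hlt
  refine hl'.2.1 (m + 1) (Or.inr ⟨z - z', ?_, ?_⟩)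
  · rw [Finset.mem_Icc, Pi.le_def, Pi.le_def]
    exact ⟨fun i => (abs_le.1 (hz i)).1, fun i => (abs_le.1 (hz i)).2⟩
  · simpa using hm

theorem measurableSet_isLevel {n N : ℕ} {Ω : Type*} [MeasurableSpace Ω]
    {C : Ω → (Fin n → ℤ) × ℤ → Prop} (hC : ∀ σ, MeasurableSet {ω | C ω σ}) (z : Fin n → ℤ)
    (h : ℕ) : MeasurableSet {ω | IsLevel N (C ω) z h} := by
  have : {ω | IsLevel N (C ω) z h} = {_ω | 1 ≤ h} ∩ ((⋂ m, {ω | Reach N (C ω) m (z, (h : ℤ))}ᶜ) ∩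
      ⋂ j : ℕ, ⋂ _ : 1 ≤ j, ⋂ _ : j < h, ⋃ m, {ω | Reach N (C ω) m (z, (j : ℤ))}) := by
    ext ω
    simp only [IsLevel, mem_ofPred_eq, mem_inter_iff, mem_iInter, mem_iUnion, mem_compl_iff]
  rw [this]
  refine (MeasurableSet.const _).inter
    ((MeasurableSet.iInter fun m => (measurableSet_reach hC m _).compl).inter ?_)
  exact MeasurableSet.iInter fun j => MeasurableSet.iInter fun _ => MeasurableSet.iInter fun _ =>
    MeasurableSet.iUnion fun m => measurableSet_reach hC m _

/-! ### Poisson processes with independent marks -/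

section Poisson

theorem finite_of_pointCount_ne_top {Ω X : Type*} {p : ℕ → Ω → X} {B : Set X} {ω : Ω}
    (h : pointCount p B ω ≠ ∞) : {k | p k ω ∈ B}.Finite := by
  refine (ENNReal.finite_const_le_of_tsum_ne_top h one_ne_zero).subset fun k hk => ?_
  have hk' : p k ω ∈ B := hk
  simp [hk']

theorem pointCount_eq_card {Ω X : Type*} {p : ℕ → Ω → X} {B : Set X} {ω : Ω} {J : Finset ℕ}
    (h : ∀ k, p k ω ∈ B ↔ k ∈ J) : pointCount p B ω = J.card := by
  rw [pointCount, tsum_eq_sum (s := J) fun k hk => by simp [(h k).not.2 hk]]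
  rw [Finset.sum_congr rfl fun k hk => indicator_of_mem ((h k).2 hk) _]
  simp

variable {Ω X : Type*} [MeasurableSpace Ω] [MeasurableSpace X]

theorem measurable_pointCount {p : ℕ → Ω → X} (hp : ∀ k, Measurable (p k)) {B : Set X}
    (hB : MeasurableSet B) : Measurable (pointCount p B) :=
  Measurable.tsum fun k => (measurable_const.indicator hB).comp (hp k)

variable {P : Measure Ω} {μ : Measure X} {p : ℕ → Ω → X}

theorem IsPoissonProcess.measure_pointCount_eq (h : IsPoissonProcess p μ P) {B : Set X}
    (hB : MeasurableSet B) (hμ : μ B ≠ ∞) (m : ℕ) :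
    P {ω | pointCount p B ω = m} = poissonMeasure (μ B).toNNReal {m} := by
  have h1 := congrArg (fun ν => ν {(m : ℝ≥0∞)}) (h.law B hB hμ)
  rw [Measure.map_apply (measurable_pointCount h.measurable hB) (measurableSet_singleton _),
    Measure.map_apply (measurable_of_countable _) (measurableSet_singleton _)] at h1
  have h2 : (fun m : ℕ => (m : ℝ≥0∞)) ⁻¹' {(m : ℝ≥0∞)} = {m} := by
    ext j
    simp
  rw [h2] at h1
  exact h1

theorem IsPoissonProcess.ae_finite (h : IsPoissonProcess p μ P) {B : Set X}
    (hB : MeasurableSet B) (hμ : μ B ≠ ∞) : ∀ᵐ ω ∂P, {k | p k ω ∈ B}.Finite := by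
  have h1 := congrArg (fun ν => ν {∞}) (h.law B hB hμ)
  rw [Measure.map_apply (measurable_pointCount h.measurable hB) (measurableSet_singleton _),
    Measure.map_apply (measurable_of_countable _) (measurableSet_singleton _)] at h1
  have h2 : (fun m : ℕ => (m : ℝ≥0∞)) ⁻¹' {∞} = ∅ := by
    ext j
    simp
  rw [h2, measure_empty] at h1
  rw [ae_iff]
  refine measure_mono_null (fun ω hω => ?_) h1
  by_contra hne
  exact hω (finite_of_pointCount_ne_top hne)

theorem tsum_poissonMeasure_mul_pow (r q : ℝ≥0) :
    ∑' m : ℕ, poissonMeasure r {m} * (q : ℝ≥0∞) ^ m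
      = ENNReal.ofReal (Real.exp (-(r * (1 - q)))) := by
  have h1 : ∀ m : ℕ, poissonMeasure r {m} * (q : ℝ≥0∞) ^ m
      = ENNReal.ofReal (Real.exp (-(r * (1 - q)))) * poissonMeasure (r * q) {m} := by
    intro m
    rw [poissonMeasure_singleton, poissonMeasure_singleton, ← ENNReal.ofReal_coe_nnreal,
      ← ENNReal.ofReal_pow q.coe_nonneg, ← ENNReal.ofReal_mul (by positivity),
      ← ENNReal.ofReal_mul (by positivity)]
    congr 1
    have : Real.exp (-(r : ℝ)) = Real.exp (-(r * (1 - q))) * Real.exp (-((r * q : ℝ≥0) : ℝ)) := by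
      rw [← Real.exp_add]
      congr 1
      push_cast
      ring
    rw [this]
    push_cast
    ring
  simp_rw [h1]
  rw [ENNReal.tsum_mul_left]
  have h2 : ∑' m : ℕ, poissonMeasure (r * q) {m} = 1 := by
    simp_rw [poissonMeasure_singleton]
    rw [← ENNReal.ofReal_tsum_of_nonneg (fun m => by positivity)
      (hasSum_one_poissonMeasure _).summable, (hasSum_one_poissonMeasure _).tsum_eq,
      ENNReal.ofReal_one]
  rw [h2, mul_one]

/-- The probability that all points of a Poisson process in the set `B` carry marks in `V`. It is
obtained by summing over the possible finite sets of indices of points in `B`. -/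
theorem IsPoissonProcess.measure_forall_mark_mem_le [IsProbabilityMeasure P]
    (h : IsPoissonProcess p μ P)
    {s : ℕ → Ω → ℝ} (hs : iIndepFun s P) (hid : ∀ k, IdentDistrib (s k) (s 0) P P)
    (hsp : IndepFun (fun ω k => s k ω) (fun ω k => p k ω) P)
    {B : Set X} (hB : MeasurableSet B) (hμ : μ B ≠ ∞) {V : Set ℝ} (hV : MeasurableSet V) :
    P {ω | ∀ k, p k ω ∈ B → s k ω ∈ V} ≤
      ENNReal.ofReal (Real.exp (-((μ B).toReal * (1 - P.real (s 0 ⁻¹' V))))) := by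
  set q : ℝ≥0 := (P (s 0 ⁻¹' V)).toNNReal with hq
  have hqP : (q : ℝ≥0∞) = P (s 0 ⁻¹' V) := ENNReal.coe_toNNReal (measure_ne_top _ _)
  set E : Finset ℕ → Set Ω := fun J => {ω | ∀ k, p k ω ∈ B ↔ k ∈ J} with hE
  have hEpre : ∀ J, E J = (fun ω k => p k ω) ⁻¹' {x : ℕ → X | ∀ k, x k ∈ B ↔ k ∈ J} :=
    fun _ => rfl
  have hEm' : ∀ J : Finset ℕ, MeasurableSet {x : ℕ → X | ∀ k, x k ∈ B ↔ k ∈ J} := by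
    intro J
    rw [ofPred_forall]
    refine MeasurableSet.iInter fun k => ?_
    have hk : MeasurableSet {x : ℕ → X | x k ∈ B} := measurable_pi_apply k hB
    by_cases hkJ : k ∈ J
    · simpa [hkJ] using hk
    · simp only [hkJ, iff_false]
      exact hk.compl
  have hEm : ∀ J, MeasurableSet (E J) := fun J =>
    (measurable_pi_lambda _ h.measurable) (hEm' J)
  have hterm : ∀ J : Finset ℕ,
      P ({ω | ∀ k, p k ω ∈ B → s k ω ∈ V} ∩ E J) ≤ P (E J) * (q : ℝ≥0∞) ^ J.card := by
    intro J
    have h1 : {ω | ∀ k, p k ω ∈ B → s k ω ∈ V} ∩ E J ⊆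
        (fun ω k => s k ω) ⁻¹' {x : ℕ → ℝ | ∀ k ∈ J, x k ∈ V} ∩
          (fun ω k => p k ω) ⁻¹' {x : ℕ → X | ∀ k, x k ∈ B ↔ k ∈ J} := by
      rintro ω ⟨h1, h2⟩
      exact ⟨fun k hk => h1 k ((h2 k).2 hk), h2⟩
    have h2 : MeasurableSet {x : ℕ → ℝ | ∀ k ∈ J, x k ∈ V} := by
      have : {x : ℕ → ℝ | ∀ k ∈ J, x k ∈ V} = ⋂ k ∈ J, (fun x : ℕ → ℝ => x k) ⁻¹' V := by
        ext x; simp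
      rw [this]
      exact Finset.measurableSet_biInter _ fun k _ => measurable_pi_apply k hV
    have h3 : P ((fun ω k => s k ω) ⁻¹' {x : ℕ → ℝ | ∀ k ∈ J, x k ∈ V}) = (q : ℝ≥0∞) ^ J.card := by
      have h4 : (fun ω k => s k ω) ⁻¹' {x : ℕ → ℝ | ∀ k ∈ J, x k ∈ V}
          = ⋂ k ∈ J, s k ⁻¹' V := by
        ext ω; simp
      rw [h4, hs.measure_inter_preimage_eq_mul J fun k _ => hV,
        Finset.prod_congr rfl fun k _ => (hid k).measure_preimage_eq hV]
      simp [hqP]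
    refine (measure_mono h1).trans ?_
    rw [hsp.measure_inter_preimage_eq_mul _ _ h2 (hEm' J), h3, mul_comm, hEpre]
  have hcover : P {ω | ∀ k, p k ω ∈ B → s k ω ∈ V} ≤
      P (⋃ J, {ω | ∀ k, p k ω ∈ B → s k ω ∈ V} ∩ E J) := by
    refine measure_mono_ae ?_
    filter_upwards [h.ae_finite hB hμ] with ω hfin hω
    exact mem_iUnion.2 ⟨hfin.toFinset, hω, fun k => by simp⟩
  have hcount : ∀ ω, ∑' J : Finset ℕ, (E J).indicator (fun _ => (q : ℝ≥0∞) ^ J.card) ω ≤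
      ∑' m : ℕ, {ω | pointCount p B ω = m}.indicator (fun _ => (q : ℝ≥0∞) ^ m) ω := by
    intro ω
    by_cases hω : ∃ J, ω ∈ E J
    · obtain ⟨J, hJ⟩ := hω
      rw [tsum_eq_single J fun J' hJ' => indicator_of_notMem (fun h' => hJ' ?_) _]
      · refine le_trans ?_ (ENNReal.le_tsum J.card)
        have : ω ∈ {ω | pointCount p B ω = (J.card : ℕ)} := pointCount_eq_card hJ
        rw [indicator_of_mem hJ, indicator_of_mem this]
      · ext k
        rw [← h' k, hJ k]
    · push Not at hω
      rw [ENNReal.tsum_eq_zero.2 fun J => indicator_of_notMem (hω J) _]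
      exact zero_le
  have hNm : ∀ m : ℕ, MeasurableSet {ω | pointCount p B ω = m} := fun m =>
    measurable_pointCount h.measurable hB (measurableSet_singleton _)
  calc P {ω | ∀ k, p k ω ∈ B → s k ω ∈ V}
      ≤ ∑' J, P ({ω | ∀ k, p k ω ∈ B → s k ω ∈ V} ∩ E J) := hcover.trans (measure_iUnion_le _)
    _ ≤ ∑' J : Finset ℕ, P (E J) * (q : ℝ≥0∞) ^ J.card := ENNReal.tsum_le_tsum hterm
    _ = ∑' J : Finset ℕ, ∫⁻ ω, (E J).indicator (fun _ => (q : ℝ≥0∞) ^ J.card) ω ∂P := by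
        refine tsum_congr fun J => ?_
        rw [lintegral_indicator_const (hEm J), mul_comm]
    _ = ∫⁻ ω, ∑' J : Finset ℕ, (E J).indicator (fun _ => (q : ℝ≥0∞) ^ J.card) ω ∂P :=
        (lintegral_tsum fun J => (measurable_const.indicator (hEm J)).aemeasurable).symm
    _ ≤ ∫⁻ ω, ∑' m : ℕ, {ω | pointCount p B ω = m}.indicator (fun _ => (q : ℝ≥0∞) ^ m) ω ∂P :=
        lintegral_mono hcount
    _ = ∑' m : ℕ, ∫⁻ ω, {ω | pointCount p B ω = m}.indicator (fun _ => (q : ℝ≥0∞) ^ m) ω ∂P :=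
        lintegral_tsum fun m => (measurable_const.indicator (hNm m)).aemeasurable
    _ = ∑' m : ℕ, poissonMeasure (μ B).toNNReal {m} * (q : ℝ≥0∞) ^ m := by
        refine tsum_congr fun m => ?_
        rw [lintegral_indicator_const (hNm m), mul_comm, h.measure_pointCount_eq hB hμ]
    _ = _ := tsum_poissonMeasure_mul_pow _ _

end Poisson

/-! ### The cells of the percolation problem -/

/-- The cell of side lengths `d` (in `ℝⁿ`) and `H` (in the vertical direction) that contains `q`.
The heights of the cells are counted from `r₁`. -/
noncomputable def cell {n : ℕ} (d H r₁ : ℝ) (q : Space n × ℝ) : (Fin n → ℤ) × ℤ :=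
  (fun i => ⌊q.1 i / d⌋, ⌊(q.2 - r₁) / H⌋)

theorem measurable_cell {n : ℕ} (d H r₁ : ℝ) : Measurable (cell (n := n) d H r₁) := by
  refine Measurable.prodMk (measurable_pi_lambda _ fun i => ?_) ?_
  · have : Measurable fun q : Space n × ℝ => q.1 i / d := by fun_prop
    exact this.floor
  · have : Measurable fun q : Space n × ℝ => (q.2 - r₁) / H := by fun_prop
    exact this.floor

theorem cell_eq_iff {n : ℕ} {d H r₁ : ℝ} (hd : 0 < d) (hH : 0 < H) (q : Space n × ℝ)
    (σ : (Fin n → ℤ) × ℤ) : cell d H r₁ q = σ ↔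
      (∀ i, q.1 i ∈ Ico (σ.1 i * d) ((σ.1 i + 1) * d)) ∧
        q.2 ∈ Ico (r₁ + σ.2 * H) (r₁ + (σ.2 + 1) * H) := by
  rw [Prod.ext_iff, funext_iff]
  refine and_congr (forall_congr' fun i => ?_) ?_
  · simp only [cell]
    rw [Int.floor_eq_iff, le_div_iff₀ hd, div_lt_iff₀ hd, mem_Ico]
  · simp only [cell]
    rw [Int.floor_eq_iff, le_div_iff₀ hH, div_lt_iff₀ hH, mem_Ico, le_sub_iff_add_le',
      sub_lt_iff_lt_add']

theorem volume_cell {n : ℕ} {d H r₁ : ℝ} (hd : 0 < d) (hH : 0 < H) (σ : (Fin n → ℤ) × ℤ) :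
    (volume : Measure (Space n × ℝ)) (cell d H r₁ ⁻¹' {σ}) = ENNReal.ofReal (d ^ n * H) := by
  have h1 : cell d H r₁ ⁻¹' {σ} =
      ((WithLp.ofLp : Space n → Fin n → ℝ) ⁻¹'
        (univ.pi fun i => Ico (σ.1 i * d) ((σ.1 i + 1) * d))) ×ˢ
      Ico (r₁ + σ.2 * H) (r₁ + (σ.2 + 1) * H) := by
    ext q
    rw [mem_preimage, mem_singleton_iff, cell_eq_iff hd hH]
    simp [Set.mem_pi]
  rw [h1, Measure.volume_eq_prod, Measure.prod_prod,
    (PiLp.volume_preserving_ofLp (Fin n)).measure_preimage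
      (MeasurableSet.univ_pi fun i => measurableSet_Ico).nullMeasurableSet,
    Real.volume_pi_Ico, Real.volume_Ico]
  have h2 : ∀ i, (σ.1 i + 1) * d - σ.1 i * d = d := fun i => by ring
  have h3 : r₁ + (σ.2 + 1) * H - (r₁ + σ.2 * H) = H := by ring
  simp only [h2, h3, Finset.prod_const, Finset.card_univ, Fintype.card_fin]
  rw [ENNReal.ofReal_mul (by positivity), ENNReal.ofReal_pow hd.le]

/-- The intensity measure of a finite union of cells above the height `r₁`. -/
theorem intensity_cells {n : ℕ} {d H r₁ : ℝ} (hd : 0 < d) (hH : 0 < H) (lam : ℝ≥0)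
    (S : Finset ((Fin n → ℤ) × ℤ)) (hS : ∀ τ ∈ S, 1 ≤ τ.2) :
    (lam • (volume : Measure (Space n × ℝ)).restrict {z | r₁ ≤ z.2}) (cell d H r₁ ⁻¹' S)
      = ENNReal.ofReal (S.card * (lam * (d ^ n * H))) := by
  have hm : ∀ σ, MeasurableSet (cell (n := n) d H r₁ ⁻¹' {σ}) := fun σ =>
    measurable_cell d H r₁ (measurableSet_singleton σ)
  rw [← sum_measure_preimage_singleton S fun σ _ => hm σ]
  have h1 : ∀ σ ∈ S, (lam • (volume : Measure (Space n × ℝ)).restrict {z | r₁ ≤ z.2})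
      (cell d H r₁ ⁻¹' {σ}) = ENNReal.ofReal (lam * (d ^ n * H)) := by
    intro σ hσ
    have hsub : cell d H r₁ ⁻¹' {σ} ⊆ {z : Space n × ℝ | r₁ ≤ z.2} := by
      intro q hq
      have := ((cell_eq_iff hd hH q σ).1 hq).2.1
      have h1 : (1 : ℝ) ≤ σ.2 := by exact_mod_cast hS σ hσ
      have h2 : 0 ≤ σ.2 * H := by positivity
      simp only [mem_ofPred_eq]
      linarith
    rw [Measure.smul_apply, Measure.restrict_eq_self _ hsub, volume_cell hd hH,
      ENNReal.ofReal_mul lam.coe_nonneg, ENNReal.smul_def, smul_eq_mul, ENNReal.ofReal_coe_nnreal]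
  rw [Finset.sum_congr rfl h1, Finset.sum_const, nsmul_eq_mul,
    ENNReal.ofReal_mul (Nat.cast_nonneg _), ENNReal.ofReal_natCast]

/-! ### The force of the obstacles -/

section Force

variable {n : ℕ} {φ : Space n × ℝ → ℝ} {r₀ r₁ : ℝ} {p : ℕ → Space n × ℝ} {s : ℕ → ℝ}

theorem obstacleForce_nonpos (hφ : IsObstacleShape φ r₀ r₁) (hs : ∀ k, 0 < s k)
    (z : Space n × ℝ) : obstacleForce φ p s z ≤ 0 :=
  tsum_nonpos fun k => mul_nonpos_of_nonneg_of_nonpos (hs k).le (hφ.nonpos _)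

theorem IsObstacleShape.radius_pos (hφ : IsObstacleShape φ r₀ r₁) : 0 < r₁ :=
  lt_of_le_of_lt (mul_nonneg (Real.sqrt_nonneg _) hφ.pos.le) hφ.radius_lt

theorem IsObstacleShape.eq_zero_of_lt_norm (hφ : IsObstacleShape φ r₀ r₁) {z : Space n × ℝ}
    (hz : r₁ < ‖z‖) : φ z = 0 := by
  refine hφ.eq_zero z.1 z.2 (hz.trans_le ?_)
  refine Real.le_sqrt_of_sq_le ?_
  rw [Prod.norm_def]
  rcases max_choice ‖z.1‖ ‖z.2‖ with h | h <;> rw [h]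
  · linarith [sq_nonneg z.2]
  · rw [Real.norm_eq_abs, sq_abs]
    linarith [sq_nonneg ‖z.1‖]

/-- The force in the core of an obstacle; local finiteness of the centres makes the sum that
defines the force finite. -/
theorem obstacleForce_le_neg (hφ : IsObstacleShape φ r₀ r₁) (hs : ∀ k, 0 < s k)
    (hfin : ∀ r, {k | ‖p k‖ ≤ r}.Finite) (k : ℕ) {x : Space n} {y : ℝ}
    (hx : ‖x - (p k).1‖ ≤ r₀) (hy : |y - (p k).2| ≤ r₀) :
    obstacleForce φ p s (x, y) ≤ -s k := by
  have hsum : Summable fun i => s i * φ ((x, y) - p i) := by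
    refine summable_of_hasFiniteSupport
      ((hfin (‖((x, y) : Space n × ℝ)‖ + r₁)).subset fun i hi => ?_)
    by_contra hlt
    have hlt : ‖((x, y) : Space n × ℝ)‖ + r₁ < ‖p i‖ := not_le.1 hlt
    refine hi ?_
    have h1 : ‖p i‖ ≤ ‖((x, y) : Space n × ℝ)‖ + ‖(x, y) - p i‖ := by
      have := norm_sub_le ((x, y) : Space n × ℝ) ((x, y) - p i)
      rwa [sub_sub_cancel] at this
    simp only [hφ.eq_zero_of_lt_norm (by linarith : r₁ < ‖(x, y) - p i‖), mul_zero]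
  have h1 : s k * φ ((x, y) - p k) ≤ -s k := by
    have : φ ((x, y) - p k) ≤ -1 := by
      refine hφ.le_neg_one _ _ (fun i => ?_) hy
      have := PiLp.norm_apply_le (x - (p k).1) i
      rw [Real.norm_eq_abs] at this
      exact this.trans hx
    have := mul_le_mul_of_nonneg_left this (hs k).le
    linarith
  have h2 := hsum.neg.le_tsum k fun i _ =>
    neg_nonneg.2 (mul_nonpos_of_nonneg_of_nonpos (hs i).le (hφ.nonpos _))
  rw [tsum_neg] at h2
  exact (neg_le_neg_iff.1 h2).trans h1

end Force

/-! ### The barriers of the selected obstacles -/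

/-- A cell is closed if it contains no centre of an obstacle of strength at least `c`. -/
def ClosedCell {n : ℕ} (d H r₁ c : ℝ) (p : ℕ → Space n × ℝ) (s : ℕ → ℝ)
    (σ : (Fin n → ℤ) × ℤ) : Prop :=
  ∀ k, cell d H r₁ (p k) = σ → s k < c

/-- The obstacles of strength at least `c` with centre in a cell of the level surface. -/
def selected {n : ℕ} (N : ℕ) (d H r₁ c : ℝ) (p : ℕ → Space n × ℝ) (s : ℕ → ℝ) : Set ℕ :=
  {k | c ≤ s k ∧ ∃ (z : Fin n → ℤ) (h : ℕ), cell d H r₁ (p k) = (z, (h : ℤ)) ∧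
    IsLevel N (ClosedCell d H r₁ c p s) z h}

/-- The barrier with radial profile `g` centred at the obstacle `k`. -/
noncomputable def barrier {n : ℕ} (g : ℝ → ℝ) (p : ℕ → Space n × ℝ) (k : ℕ) (x : Space n) : ℝ :=
  g (‖x - (p k).1‖ ^ 2) + (p k).2

theorem norm_sub_le_of_floor_eq {n : ℕ} {d : ℝ} (hd : 0 < d) {x y : Space n}
    (h : ∀ i, ⌊x i / d⌋ = ⌊y i / d⌋) : ‖x - y‖ ≤ n * d := by
  rcases Nat.eq_zero_or_pos n with rfl | hn
  · simp [Subsingleton.elim x y]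
  have hn' : (1 : ℝ) ≤ n := by exact_mod_cast hn
  refine le_of_sq_le_sq ?_ (by positivity)
  rw [EuclideanSpace.real_norm_sq_eq]
  have h1 : ∀ i, (x - y) i ^ 2 ≤ d ^ 2 := by
    intro i
    have h2 := Int.abs_sub_lt_one_of_floor_eq_floor (h i)
    rw [← sub_div, abs_div, abs_of_pos hd, div_lt_one hd] at h2
    rw [sq_le_sq, abs_of_pos hd]
    exact h2.le
  calc ∑ i, (x - y) i ^ 2 ≤ ∑ _i : Fin n, d ^ 2 := Finset.sum_le_sum fun i _ => h1 i
    _ = n * d ^ 2 := by simp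
    _ ≤ (n * d) ^ 2 := by
        have : 0 < n * d ^ 2 := by positivity
        nlinarith

/-- The barriers of the selected obstacles form a barrier family. For the gap condition, note that
by the Lipschitz property of the level surface the centre of the nearer obstacle lies at most `2 H`
above that of the farther one, while the profile of its barrier is lower by at least `3 H`. -/
theorem isBarrierFamily_selected {n : ℕ} (hn : 1 ≤ n) {φ : Space n × ℝ → ℝ} {r₀ r₁ : ℝ}
    (hφ : IsObstacleShape φ r₀ r₁) {g : ℝ → ℝ} {d F₁ H c F : ℝ} (hd : 0 < d) (hH : 0 < H)
    (hF : 0 < F) (hF₁ : F < F₁) (hFc : F < c / 2)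
    (hgd : ∀ s, 0 ≤ s → ContDiffAt ℝ 2 g s) (hgb : ∀ s, 0 ≤ s → 0 ≤ g s ∧ g s ≤ r₀ / 4)
    (hgm : MonotoneOn g (Ici 0)) (hgH : g ((2 * (n * d)) ^ 2) - g ((n * d) ^ 2) = 3 * H)
    (hin : ∀ X x : Space n, meanCurvature (fun z => g (‖z - X‖ ^ 2)) x ≤ c / 2)
    (hout : ∀ X x : Space n, r₀ ≤ ‖x - X‖ → ‖x - X‖ ≤ 3 * (n * d) →
      meanCurvature (fun z => g (‖z - X‖ ^ 2)) x ≤ -F₁)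
    {p : ℕ → Space n × ℝ} {s : ℕ → ℝ} (hs : ∀ k, 0 < s k)
    (hfin : ∀ r, {k | ‖p k‖ ≤ r}.Finite)
    (hlevel : ∀ z, ∃ h : ℕ, IsLevel (3 * n + 1) (ClosedCell d H r₁ c p s) z h) :
    IsBarrierFamily (selected (3 * n + 1) d H r₁ c p s) (fun k => (p k).1) (barrier g p)
      (obstacleForce φ p s) F (r₀ / 2) (n * d) H := by
  have hn' : (1 : ℝ) ≤ n := by exact_mod_cast hn
  have hr₀ := hφ.pos
  have hr₁ := hφ.radius_pos
  have hnd : 0 < n * d := by positivity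
  -- every cell of `ℝⁿ` contains the centre of a selected obstacle
  have hpick : ∀ x : Space n, ∃ k ∈ selected (3 * n + 1) d H r₁ c p s, ∃ h : ℕ,
      cell d H r₁ (p k) = (fun i => ⌊x i / d⌋, (h : ℤ)) ∧
      IsLevel (3 * n + 1) (ClosedCell d H r₁ c p s) (fun i => ⌊x i / d⌋) h ∧
      ‖x - (p k).1‖ ≤ n * d := by
    intro x
    obtain ⟨h, hl⟩ := hlevel fun i => ⌊x i / d⌋
    have hopen := hl.not_closed
    simp only [ClosedCell, not_forall, not_lt] at hopen
    obtain ⟨k, hk, hck⟩ := hopen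
    refine ⟨k, ⟨hck, _, h, hk, hl⟩, h, hk, hl, norm_sub_le_of_floor_eq hd fun i => ?_⟩
    have := congrFun (congrArg Prod.fst hk) i
    simpa [cell] using this.symm
  refine ⟨hF, by linarith, hnd, hH, obstacleForce_nonpos hφ hs, ?_, ?_, ?_, ?_, ?_, ?_, ?_⟩
  · intro k x
    have h1 : ContDiffAt ℝ 2 (fun z : Space n => ‖z - (p k).1‖ ^ 2) x :=
      ((contDiff_id.sub contDiff_const).norm_sq ℝ).contDiffAt
    exact ((hgd _ (sq_nonneg _)).comp x h1).add contDiffAt_const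
  · rintro k ⟨_, z, h, hz, hl⟩ x
    have h1 := ((cell_eq_iff hd hH _ _).1 hz).2.1
    have h2 : (0 : ℝ) ≤ ((h : ℤ) : ℝ) * H := by positivity
    have h3 := (hgb (‖x - (p k).1‖ ^ 2) (sq_nonneg _)).1
    simp only [barrier]
    linarith
  · rintro k ⟨hck, _⟩ x hx y hy1 hy2
    have hκ : meanCurvature (barrier g p k) x = meanCurvature (fun z => g (‖z - (p k).1‖ ^ 2)) x :=
      meanCurvature_add_const (fun z => g (‖z - (p k).1‖ ^ 2)) (p k).2 x
    rw [hκ]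
    rcases le_total ‖x - (p k).1‖ r₀ with hle | hge
    · obtain ⟨h1, h2⟩ := hgb (‖x - (p k).1‖ ^ 2) (sq_nonneg _)
      simp only [barrier] at hy1 hy2
      have h3 := obstacleForce_le_neg hφ hs hfin k (y := y) hle
        (abs_le.2 ⟨by linarith, by linarith⟩)
      have h4 := hin (p k).1 x
      linarith
    · have h1 := hout _ _ hge hx.le
      have h2 := obstacleForce_nonpos (p := p) hφ hs (x, y)
      linarith
  · intro k x x'
    have h1 := hgb (‖x - (p k).1‖ ^ 2) (sq_nonneg _)
    have h2 := hgb (‖x' - (p k).1‖ ^ 2) (sq_nonneg _)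
    simp only [barrier]
    linarith
  · intro x
    obtain ⟨k, hk, _, _, _, hx⟩ := hpick x
    exact ⟨k, hk, hx⟩
  · rintro k ⟨_, z, h, hz, hl⟩ x hx1 hx2
    obtain ⟨k', hk', h', hz', hl', hx'⟩ := hpick x
    refine ⟨k', hk', hx', ?_⟩
    have hzz : ∀ i, |⌊x i / d⌋ - z i| ≤ ((3 * n + 1 : ℕ) : ℤ) := by
      intro i
      have h1 : z i = ⌊(p k).1 i / d⌋ := (congrFun (congrArg Prod.fst hz) i).symm
      have h2 : |x i - (p k).1 i| ≤ 3 * (n * d) := by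
        have := PiLp.norm_apply_le (x - (p k).1) i
        rw [Real.norm_eq_abs] at this
        exact this.trans hx2.le
      have h3 : |x i / d - (p k).1 i / d| ≤ 3 * n := by
        rw [← sub_div, abs_div, abs_of_pos hd, div_le_iff₀ hd]
        linarith
      have h4 : |((⌊x i / d⌋ - z i : ℤ) : ℝ)| < ((3 * n + 1 : ℕ) : ℝ) := by
        rw [h1]
        push_cast
        have h5 := Int.floor_le (x i / d)
        have h6 := Int.lt_floor_add_one (x i / d)
        have h7 := Int.floor_le ((p k).1 i / d)
        have h8 := Int.lt_floor_add_one ((p k).1 i / d)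
        rw [abs_le] at h3
        rw [abs_lt]
        constructor <;> linarith [h3.1, h3.2]
      exact_mod_cast h4.le
    have hhh : h' ≤ h + 1 := hl'.le_add_one hl hzz
    have hhh' : ((h' : ℤ) : ℝ) ≤ ((h : ℤ) : ℝ) + 1 := by exact_mod_cast hhh
    have hlow := ((cell_eq_iff hd hH _ _).1 hz).2.1
    have hup := ((cell_eq_iff hd hH _ _).1 hz').2.2
    have hmul : (((h' : ℤ) : ℝ) + 1) * H ≤ (((h : ℤ) : ℝ) + 2) * H := by
      refine mul_le_mul_of_nonneg_right ?_ hH.le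
      linarith
    have hg1 : g (‖x - (p k').1‖ ^ 2) ≤ g ((n * d) ^ 2) :=
      hgm (mem_Ici.2 (by positivity)) (mem_Ici.2 (by positivity)) (by gcongr)
    have hg2 : g ((2 * (n * d)) ^ 2) ≤ g (‖x - (p k).1‖ ^ 2) :=
      hgm (mem_Ici.2 (by positivity)) (mem_Ici.2 (by positivity)) (by gcongr)
    simp only [barrier]
    simp only at hup hlow
    linarith
  · intro r
    choose L hL using hlevel
    set Z : Finset (Fin n → ℤ) := Finset.Icc (fun _ => ⌊-r / d⌋) (fun _ => ⌊r / d⌋) with hZ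
    have hcell : ∀ σ : (Fin n → ℤ) × ℤ, {k | cell d H r₁ (p k) = σ}.Finite := by
      intro σ
      have hbdd : Bornology.IsBounded (cell (n := n) d H r₁ ⁻¹' {σ}) := by
        have h1 : Bornology.IsBounded (Metric.closedBall
            (WithLp.toLp 2 fun i => σ.1 i * d : Space n) (n * d) ×ˢ
            Icc (r₁ + σ.2 * H) (r₁ + (σ.2 + 1) * H)) :=
          Metric.isBounded_closedBall.prod (Metric.isBounded_Icc _ _)
        refine h1.subset fun q hq => ?_
        have hq' : cell d H r₁ q = σ := hq
        obtain ⟨h2, h3⟩ := (cell_eq_iff hd hH q σ).1 hq'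
        refine ⟨?_, h3.1, h3.2.le⟩
        rw [Metric.mem_closedBall, dist_eq_norm]
        refine norm_sub_le_of_floor_eq hd fun i => ?_
        have h4 : ⌊q.1 i / d⌋ = σ.1 i := congrFun (congrArg Prod.fst hq') i
        rw [h4]
        simp [hd.ne']
      obtain ⟨R, hR⟩ := hbdd.exists_norm_le
      exact (hfin R).subset fun k hk => hR _ hk
    refine (Z.finite_toSet.biUnion fun z _ => hcell (z, (L z : ℤ))).subset ?_
    rintro k ⟨⟨_, z, h, hz, hl⟩, hkr⟩
    refine mem_biUnion (x := z) ?_ ?_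
    · rw [Finset.mem_coe, hZ, Finset.mem_Icc, Pi.le_def, Pi.le_def]
      have h1 : ∀ i, z i = ⌊(p k).1 i / d⌋ := fun i => (congrFun (congrArg Prod.fst hz) i).symm
      have h2 : ∀ i, |(p k).1 i| ≤ r := fun i => by
        have := PiLp.norm_apply_le (p k).1 i
        rw [Real.norm_eq_abs] at this
        exact this.trans hkr
      constructor <;> intro i <;> rw [h1] <;> refine Int.floor_le_floor ?_ <;> gcongr
      · exact (abs_le.1 (h2 i)).1
      · exact (abs_le.1 (h2 i)).2
    · rw [(hL z).unique hl]
      exact hz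

/-! ### Measurability and the choice of the parameters -/

section Random

variable {n : ℕ} {Ω : Type*} [MeasurableSpace Ω] {p : ℕ → Ω → Space n × ℝ} {s : ℕ → Ω → ℝ}

theorem measurableSet_closedCell (hp : ∀ k, Measurable (p k)) (hs : ∀ k, Measurable (s k))
    (d H r₁ c : ℝ) (σ : (Fin n → ℤ) × ℤ) :
    MeasurableSet {ω | ClosedCell d H r₁ c (fun k => p k ω) (fun k => s k ω) σ} := by
  have : {ω | ClosedCell d H r₁ c (fun k => p k ω) (fun k => s k ω) σ} =
      ⋂ k, ((fun ω => cell d H r₁ (p k ω)) ⁻¹' {σ})ᶜ ∪ s k ⁻¹' Iio c := by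
    ext ω
    simp [ClosedCell, imp_iff_not_or]
  rw [this]
  exact MeasurableSet.iInter fun k =>
    (((measurable_cell d H r₁).comp (hp k)) (measurableSet_singleton σ)).compl.union
      (hs k measurableSet_Iio)

theorem measurableSet_mem_selected (hp : ∀ k, Measurable (p k)) (hs : ∀ k, Measurable (s k))
    (N : ℕ) (d H r₁ c : ℝ) (k : ℕ) :
    MeasurableSet {ω | k ∈ selected N d H r₁ c (fun k => p k ω) (fun k => s k ω)} := by
  have : {ω | k ∈ selected N d H r₁ c (fun k => p k ω) (fun k => s k ω)} =
      s k ⁻¹' Ici c ∩ ⋃ (z : Fin n → ℤ) (h : ℕ),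
        ((fun ω => cell d H r₁ (p k ω)) ⁻¹' {(z, (h : ℤ))} ∩
          {ω | IsLevel N (ClosedCell d H r₁ c (fun k => p k ω) (fun k => s k ω)) z h}) := by
    ext ω
    simp [selected]
  rw [this]
  refine (hs k measurableSet_Ici).inter
    (MeasurableSet.iUnion fun z => MeasurableSet.iUnion fun h => ?_)
  exact (((measurable_cell d H r₁).comp (hp k)) (measurableSet_singleton _)).inter
    (measurableSet_isLevel (measurableSet_closedCell hp hs d H r₁ c) z h)

theorem measurable_envelope (hp : ∀ k, Measurable (p k)) (hs : ∀ k, Measurable (s k))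
    {g : ℝ → ℝ} (hg : ∀ t, 0 ≤ t → ContinuousAt g t) (N : ℕ) (d H r₁ c R : ℝ) :
    Measurable fun q : Space n × Ω =>
      envelope (selected N d H r₁ c (fun k => p k q.2) (fun k => s k q.2))
        (fun k => (p k q.2).1) (barrier g (fun k => p k q.2)) R q.1 := by
  classical
  refine Measurable.ennreal_toReal (Measurable.iInf fun k => ?_)
  have hX : Measurable fun q : Space n × Ω => q.1 - (p k q.2).1 :=
    measurable_fst.sub (((hp k).comp measurable_snd).fst)
  have hgc : Continuous fun v : Space n => g (‖v‖ ^ 2) := by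
    refine continuous_iff_continuousAt.2 fun v => ?_
    exact ContinuousAt.comp (f := fun v : Space n => ‖v‖ ^ 2) (hg _ (sq_nonneg _))
      (by fun_prop)
  have hval : Measurable fun q : Space n × Ω =>
      ENNReal.ofReal (barrier g (fun k => p k q.2) k q.1) :=
    ((hgc.measurable.comp hX).add (((hp k).comp measurable_snd).snd)).ennreal_ofReal
  have hset : MeasurableSet {q : Space n × Ω |
      k ∈ selected N d H r₁ c (fun k => p k q.2) (fun k => s k q.2) ∧
        ‖q.1 - (p k q.2).1‖ < R} :=
    (measurable_snd (measurableSet_mem_selected hp hs N d H r₁ c k)).inter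
      (measurableSet_lt hX.norm measurable_const)
  simp only [iInf_eq_if]
  exact Measurable.ite hset hval measurable_const

end Random

theorem exists_measureReal_lt_one {Ω : Type*} [MeasurableSpace Ω] {P : Measure Ω}
    [IsProbabilityMeasure P] {s : Ω → ℝ} (hs : Measurable s) (hpos : ∀ᵐ ω ∂P, 0 < s ω) :
    ∃ c : ℝ, 0 < c ∧ P.real (s ⁻¹' Iio c) < 1 := by
  by_contra! hcon
  have hnull : ∀ m : ℕ, P (s ⁻¹' Ici (1 / ((m : ℝ) + 1))) = 0 := by
    intro m
    have h1 := hcon (1 / ((m : ℝ) + 1)) (by positivity)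
    have h2 := probReal_add_probReal_compl (μ := P)
      (hs (measurableSet_Iio (a := 1 / ((m : ℝ) + 1))))
    have h3 : (s ⁻¹' Iio (1 / ((m : ℝ) + 1)))ᶜ = s ⁻¹' Ici (1 / ((m : ℝ) + 1)) := by
      rw [← preimage_compl, compl_Iio]
    rw [h3] at h2
    have h4 : P.real (s ⁻¹' Ici (1 / ((m : ℝ) + 1))) = 0 :=
      le_antisymm (by linarith) measureReal_nonneg
    exact (measureReal_eq_zero_iff).1 h4
  have hall : ∀ᵐ ω ∂P, ∀ m : ℕ, ω ∉ s ⁻¹' Ici (1 / ((m : ℝ) + 1)) :=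
    ae_all_iff.2 fun m => measure_eq_zero_iff_ae_notMem.1 (hnull m)
  obtain ⟨ω, h1, h2⟩ := (hpos.and hall).exists
  obtain ⟨m, hm⟩ := exists_nat_one_div_lt h1
  exact h2 m hm.le

/-- If the cells have sufficiently large volume, almost surely every column has a finite level. -/
theorem IsObstacleField.ae_exists_isLevel {n N : ℕ} {Ω : Type*} [MeasurableSpace Ω] {P : Measure Ω}
    [IsProbabilityMeasure P] {p : ℕ → Ω → Space n × ℝ} {s : ℕ → Ω → ℝ} {r₁ : ℝ} {lam : ℝ≥0}
    (h : IsObstacleField P p s r₁ lam) {d H c L : ℝ} (hd : 0 < d) (hH : 0 < H)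
    (hL : 2 * L ≤ lam * (d ^ n * H) * (1 - P.real (s 0 ⁻¹' Iio c)))
    (hLN : Real.exp (-L) *
      ((Finset.Icc (fun _ : Fin n => -(N : ℤ)) (fun _ => (N : ℤ))).card + 1) ≤ 1 / 2) :
    ∀ᵐ ω ∂P, ∀ z, ∃ j : ℕ,
      IsLevel N (ClosedCell d H r₁ c (fun k => p k ω) (fun k => s k ω)) z j := by
  have key := ae_exists_not_reach (n := n) (N := N) (P := P)
    (C := fun ω => ClosedCell d H r₁ c (fun k => p k ω) (fun k => s k ω))
    (θ := ENNReal.ofReal (Real.exp (-L))) ?_ ?_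
  · filter_upwards [key] with ω hω z using exists_isLevel (hω z)
  · have h1 := ENNReal.ofReal_le_ofReal hLN
    rw [ENNReal.ofReal_mul (Real.exp_pos _).le, ENNReal.ofReal_add (by positivity) zero_le_one,
      ENNReal.ofReal_natCast, ENNReal.ofReal_one] at h1
    refine h1.trans (le_of_eq ?_)
    rw [ENNReal.ofReal_div_of_pos two_pos]
    simp
  · intro S hS
    have hμ := intensity_cells (n := n) (r₁ := r₁) hd hH lam S hS
    have h1 := h.poisson.measure_forall_mark_mem_le h.strength_indep h.strength_identDistrib
      h.indep (B := cell d H r₁ ⁻¹' S)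
      (measurable_cell d H r₁ S.measurableSet)
      (by rw [hμ]; exact ENNReal.ofReal_ne_top) (measurableSet_Iio (a := c))
    rw [hμ, ENNReal.toReal_ofReal (by positivity)] at h1
    calc P {ω | ∀ τ ∈ S, ClosedCell d H r₁ c (fun k => p k ω) (fun k => s k ω) τ}
        ≤ P {ω | ∀ k, p k ω ∈ cell d H r₁ ⁻¹' (S : Set ((Fin n → ℤ) × ℤ)) → s k ω ∈ Iio c} :=
          measure_mono fun ω hω k hk => hω _ hk k rfl
      _ ≤ _ := h1
      _ ≤ ENNReal.ofReal (Real.exp (-L) ^ (2 * S.card)) := by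
          refine ENNReal.ofReal_le_ofReal ?_
          rw [← Real.exp_nat_mul]
          refine Real.exp_le_exp.2 ?_
          push_cast
          have := mul_le_mul_of_nonneg_left hL (Nat.cast_nonneg (α := ℝ) S.card)
          linarith
      _ = _ := ENNReal.ofReal_pow (Real.exp_pos _).le _

theorem IsObstacleField.ae_locallyFinite {n : ℕ} {Ω : Type*} [MeasurableSpace Ω] {P : Measure Ω}
    {p : ℕ → Ω → Space n × ℝ} {s : ℕ → Ω → ℝ} {r₁ : ℝ} {lam : ℝ≥0}
    (h : IsObstacleField P p s r₁ lam) : ∀ᵐ ω ∂P, ∀ r : ℝ, {k | ‖p k ω‖ ≤ r}.Finite := by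
  have h1 : ∀ᵐ ω ∂P, ∀ m : ℕ, {k | p k ω ∈ Metric.closedBall (0 : Space n × ℝ) m}.Finite := by
    refine ae_all_iff.2 fun m => h.poisson.ae_finite measurableSet_closedBall ?_
    have hball : (volume : Measure (Space n × ℝ)) (Metric.closedBall 0 m) ≠ ∞ :=
      (isCompact_closedBall _ _).measure_lt_top.ne
    have hrestr := ne_top_of_le_ne_top hball
      (Measure.restrict_apply_le {z : Space n × ℝ | r₁ ≤ z.2} (Metric.closedBall 0 m))
    rw [Measure.smul_apply, ENNReal.smul_def, smul_eq_mul]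
    exact ENNReal.mul_ne_top ENNReal.coe_ne_top hrestr
  filter_upwards [h1] with ω hω r
  obtain ⟨m, hm⟩ := exists_nat_ge r
  refine (hω m).subset fun k hk => ?_
  rw [mem_ofPred_eq, mem_closedBall_zero_iff]
  exact le_trans hk hm

end PinnedMCF

theorem theorem3 (n : ℕ) (hn : 1 ≤ n)
    {Ω : Type*} [MeasurableSpace Ω] (P : MeasureTheory.Measure Ω)
    [MeasureTheory.IsProbabilityMeasure P]
    (φ : PinnedMCF.Space n × ℝ → ℝ) (r₀ r₁ : ℝ) (hφ : PinnedMCF.IsObstacleShape φ r₀ r₁)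
    (p : ℕ → Ω → PinnedMCF.Space n × ℝ) (s : ℕ → Ω → ℝ) (lam : ℝ≥0)
    (hps : PinnedMCF.IsObstacleField P p s r₁ lam) :
    ∃ Fstar : ℝ, 0 < Fstar ∧ ∃ w : PinnedMCF.Space n → Ω → ℝ,
      (∀ x ω, 0 ≤ w x ω) ∧
      Measurable (fun q : PinnedMCF.Space n × Ω => w q.1 q.2) ∧
      ∀ᵐ ω ∂P,
        PinnedMCF.IsStationarySupersolution
          (PinnedMCF.obstacleForce φ (fun k => p k ω) (fun k => s k ω)) Fstar
          (fun x => w x ω) ∧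
        ∀ F : ℝ, F ≤ Fstar → ∀ (T : ℝ) (u : PinnedMCF.Space n → ℝ → ℝ),
          PinnedMCF.IsForcedMCF
            (PinnedMCF.obstacleForce φ (fun k => p k ω) (fun k => s k ω)) F T u →
          ∀ x : PinnedMCF.Space n, ∀ t ∈ Ico 0 T, u x t ≤ w x ω := by
  obtain ⟨c, hc, hq⟩ := PinnedMCF.exists_measureReal_lt_one (hps.strength_measurable 0)
    (hps.strength_pos 0)
  set M : ℝ := (Finset.Icc (fun _ : Fin n => -((3 * n + 1 : ℕ) : ℤ))
    (fun _ => ((3 * n + 1 : ℕ) : ℤ))).card + 1 with hM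
  have hM0 : 0 < M := by positivity
  have hrate : 0 < (lam : ℝ) * (1 - P.real (s 0 ⁻¹' Iio c)) :=
    mul_pos (by exact_mod_cast hps.intensity_pos) (by linarith)
  -- the volume of the cells must be at least `K / 3`
  obtain ⟨g, d, F₁, hd, hF₁, hgd, hgb, hgm, hgH, hK, hin, hout⟩ :=
    PinnedMCF.exists_profile n hn (c := c / 2) hφ.pos (by linarith)
      (K := 3 * (2 * Real.log (2 * M) / (lam * (1 - P.real (s 0 ⁻¹' Iio c)))))
  set H : ℝ := (g ((2 * (n * d)) ^ 2) - g ((n * d) ^ 2)) / 3 with hHdef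
  have hH : 0 < H := by linarith
  have hL : 2 * Real.log (2 * M) ≤ lam * (d ^ n * H) * (1 - P.real (s 0 ⁻¹' Iio c)) := by
    have h1 : 2 * Real.log (2 * M) / (lam * (1 - P.real (s 0 ⁻¹' Iio c))) ≤ d ^ n * H := by
      rw [hHdef]
      linarith
    rw [div_le_iff₀ hrate] at h1
    linarith
  have hLN : Real.exp (-Real.log (2 * M)) * M ≤ 1 / 2 := by
    rw [Real.exp_neg, Real.exp_log (by positivity)]
    refine le_of_eq ?_
    field_simp
  have hmeas := PinnedMCF.measurable_envelope hps.poisson.measurable hps.strength_measurable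
    (fun t ht => (hgd t ht).continuousAt) (3 * n + 1) d H r₁ c (3 * (n * d))
  refine ⟨min F₁ (c / 2) / 2, by positivity, fun x ω =>
    PinnedMCF.envelope (PinnedMCF.selected (3 * n + 1) d H r₁ c (fun k => p k ω) (fun k => s k ω))
      (fun k => (p k ω).1) (PinnedMCF.barrier g (fun k => p k ω)) (3 * (n * d)) x,
    fun x ω => PinnedMCF.envelope_nonneg _ _ _ _ _, hmeas, ?_⟩
  have hmin : 0 < min F₁ (c / 2) := by positivity
  have hmin1 := min_le_left F₁ (c / 2)
  have hmin2 := min_le_right F₁ (c / 2)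
  filter_upwards [ae_all_iff.2 hps.strength_pos, hps.ae_locallyFinite,
    hps.ae_exists_isLevel hd hH hL hLN] with ω hs hfin hlevel
  have hfam := PinnedMCF.isBarrierFamily_selected hn hφ (F := min F₁ (c / 2) / 2) hd hH
    (by linarith) (by linarith) (by linarith) hgd hgb hgm (by rw [hHdef]; ring) hin hout hs hfin
    hlevel
  exact ⟨hfam.envelope_supersolution, fun F hF T u hu x t ht => hfam.le_envelope hn hu hF x t ht⟩
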